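/- Let $1<n<k$ be integers, let $\omega\le\min(k/n,n)-1$, and let $B_1,\dots,B_n\subset\{1,\dots,k\}$ be mutually disjoint sets of frequencies ("bands") with $|B_i|\le\omega$. For $x\in\mathbb{R}^k$ let $\hat x$ be its discrete Fourier transform. Let $\phi(x)=W_2\,\mathrm{ReLU}(W_1x)+b$ with $W_1\in\mathbb{R}^{m\times k}$, $W_2\in\mathbb{R}^{d\times m}$, $b\in\mathbb{R}^d$, and apply $\phi$ to a matrix columnwise. For a matrix $A$ with singular values $\sigma_1\ge\sigma_2\ge\cdots$ put $\mathrm{rank}_\varepsilon(A)=|\{j:\sigma_j(A)>\varepsilon\sigma_1(A)\}|$ and $\text{stab-rank}(A)=\|A\|_F^2/\|A\|_2^2$ (read as $0$ if $A=0$). (1) For all $c_0,C_0>0$ there is $K>0$, depending only on $c_0$ and $C_0$, such that the following holds for all $k,n,\omega,B_1,\dots,B_n$ as above. Let $v_1,\dots,v_n\in\mathbb{R}^k$ be unit vectors with $\mathrm{supp}(\hat v_i)\subset B_j$ for all $i$ and one common $j$, and let $V=[v_1\cdots v_n]$. For all $m,d$ and all $W_1,W_2,b$ with $\|\phi(V)\|_2\ge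 c_0\|W_2\|_2\|W_1\|_2\|V\|_2$ and $\|b\mathbf 1_n^\top\|_F\le C_0\|W_2\,\mathrm{ReLU}(W_1V)\|_F$, $$\mathrm{rank}_\varepsilon(\phi(V))\le K\varepsilon^{-2}\omega\quad\text{for every }0<\varepsilon\le1,\qquad \text{stab-rank}(\phi(V))\le K\omega .$$ (2) There are universal constants $\varepsilon>0$ and $C>0$ such that for all $0<a_1\le a_2$ there is $c>0$, depending only on $a_1,a_2$, for which the following holds for all $k,n,\omega,B_1,\dots,B_n$ as above. Let $u_1,\dots,u_n\in\mathbb{R}^k$ be unit vectors with $\mathrm{supp}(\hat u_i)\subset B_i$ for every $i$, and let $U=[u_1\cdots u_n]$. Let $\alpha,\beta>0$, let the entries of $W_1$ and $W_2$ be jointly independent, those of $W_1$ with law $\mathcal N(0,\alpha)$ and those of $W_2$ with law $\mathcal N(0,\beta)$ ($\alpha$, $\beta$ are the variances), and let $b=-\sqrt{\alpha}\,W_2\mathbf 1_m/\sqrt{2\pi}$ (which is $-W_2\mathbf 1_m/\sqrt{2\pi}$ for $\alpha=1$). If $0<\delta<1$, $m\ge C\log(1/\delta)$, $d\ge C\log(n/\delta)$,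 $m>n$ and $a_1\le m/d\le a_2$, then with probability at least $1-\delta$ $$\mathrm{rank}_\varepsilon(\phi(U))\ge c\,n\quad\text{and}\quad\text{stab-rank}(\phi(U))\ge c\,n .$$ -/

import Mathlib

open MeasureTheory ProbabilityTheory
open scoped NNReal

/-- The discrete Fourier transform of a real patch of size `k`; the frequencies
`1, …, k` (equivalently, the residues modulo `k`) are indexed by `Fin k`. -/
noncomputable def patchDFT {k : ℕ} [NeZero k] (x : EuclideanSpace ℝ (Fin k)) (j : Fin k) : ℂ :=
  ZMod.dft (fun t : ZMod k => (x ((ZMod.finEquiv k).symm t) : ℂ)) (ZMod.finEquiv k j)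

/-- The DFT support of the patch `x` lies in the band `B`. -/
def SupportedInBand {k : ℕ} [NeZero k] (x : EuclideanSpace ℝ (Fin k)) (B : Finset (Fin k)) :
    Prop :=
  Function.support (patchDFT x) ⊆ (B : Set (Fin k))

/-- `n` mutually disjoint frequency bands in `[k]`, each with at most `ω` elements, where
`1 < n < k` and `ω ≤ min (k / n) n - 1`. -/
structure IsBandFamily (k n : ℕ) (ω : ℝ) (B : Fin n → Finset (Fin k)) : Prop where
  one_lt : 1 < n
  lt_size : n < k
  bandwidth_le : ω ≤ min ((k : ℝ) / n) n - 1
  disjoint : Pairwise fun i j => Disjoint (B i) (B j)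
  card_le : ∀ i, ((B i).card : ℝ) ≤ ω

/-- The matrix whose columns are the given patches. -/
def patchMatrix {k n : ℕ} (v : Fin n → EuclideanSpace ℝ (Fin k)) : Matrix (Fin k) (Fin n) ℝ :=
  Matrix.of fun t i => v i t

/-- The rectified linear unit. -/
def relu (t : ℝ) : ℝ := max t 0

/-- The embedding `φ(x) = W₂ ReLU(W₁ x) + b`. -/
def embed {k m d : ℕ} (W₁ : Matrix (Fin m) (Fin k) ℝ) (W₂ : Matrix (Fin d) (Fin m) ℝ)
    (b : Fin d → ℝ) (x : Fin k → ℝ) : Fin d → ℝ :=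
  W₂.mulVec (fun s => relu (W₁.mulVec x s)) + b

/-- `φ(X)`: the embedding applied to every column of `X`. -/
def embedMatrix {k m d n : ℕ} (W₁ : Matrix (Fin m) (Fin k) ℝ) (W₂ : Matrix (Fin d) (Fin m) ℝ)
    (b : Fin d → ℝ) (X : Matrix (Fin k) (Fin n) ℝ) : Matrix (Fin d) (Fin n) ℝ :=
  Matrix.of fun r i => embed W₁ W₂ b (fun t => X t i) r

/-- The spectral norm: the operator norm between Euclidean spaces. -/
noncomputable def specNorm {p q : ℕ} (A : Matrix (Fin p) (Fin q) ℝ) : ℝ :=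
  ‖(Matrix.toEuclideanLin A).toContinuousLinearMap‖

/-- The Frobenius norm. -/
noncomputable def frobNorm {p q : ℕ} (A : Matrix (Fin p) (Fin q) ℝ) : ℝ :=
  √(∑ i, ∑ j, A i j ^ 2)

/-- The singular values in decreasing order; `singVal A 0` is the largest one, and the sequence is
continued by zeros. -/
noncomputable def singVal {p q : ℕ} (A : Matrix (Fin p) (Fin q) ℝ) (j : ℕ) : ℝ :=
  (Matrix.toEuclideanLin A).singularValues j

/-- The `ε`-rank: the number of singular values larger than `ε` times the largest one. -/
noncomputable def epsRank {p q : ℕ} (ε : ℝ) (A : Matrix (Fin p) (Fin q) ℝ) : ℕ :=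
  Set.ncard {j : ℕ | ε * singVal A 0 < singVal A j}

/-- The stable rank `‖A‖_F² / ‖A‖₂²` (zero for `A = 0`). -/
noncomputable def stabRank {p q : ℕ} (A : Matrix (Fin p) (Fin q) ℝ) : ℝ :=
  frobNorm A ^ 2 / specNorm A ^ 2

/-- The entries of the random matrices `W₁` and `W₂` are jointly independent; those of `W₁` have
law `N(0, α)` and those of `W₂` have law `N(0, β)`, where `α` and `β` are the variances. -/
structure IsGaussianPair {k m d : ℕ} {Ω : Type*} [MeasurableSpace Ω] (P : Measure Ω) (α β : ℝ≥0)
    (W₁ : Ω → Matrix (Fin m) (Fin k) ℝ) (W₂ : Ω → Matrix (Fin d) (Fin m) ℝ) : Prop where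
  law₁ : ∀ s t, HasLaw (fun w => W₁ w s t) (gaussianReal 0 α) P
  law₂ : ∀ r s, HasLaw (fun w => W₂ w r s) (gaussianReal 0 β) P
  indep : iIndepFun
    (fun (e : (Fin m × Fin k) ⊕ (Fin d × Fin m)) (w : Ω) =>
      Sum.elim (fun a => W₁ w a.1 a.2) (fun a => W₂ w a.1 a.2) e) P

/-- The bias `b = -√α W₂ 1 / √(2π)`. Since `√α / √(2π)` is the mean of `ReLU(g)` for
`g ∼ N(0, α)`, it centers the hidden layer; for `α = 1` it is `-W₂ 1 / √(2π)`. -/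
noncomputable def centeringBias {m d : ℕ} (α : ℝ≥0) (W₂ : Matrix (Fin d) (Fin m) ℝ) :
    Fin d → ℝ :=
  -((√(α : ℝ) / √(2 * Real.pi)) • W₂.mulVec (fun _ => 1))

/-!
Both parts compare `‖A‖_F²` with `‖A‖₂²` for `A = φ(X)`. Since the squared singular values add up to
`‖A‖_F²` and the largest singular value is `‖A‖₂` (`sum_sq_singVal`, `specNorm_eq_singVal_zero`), an
upper bound for the quotient bounds both ranks from above (`epsRank_le_and_stabRank_le`), and a
lower bound of the order of the smaller dimension bounds both from below
(`mul_min_le_epsRank_and_stabRank`).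

For patches of one band, the columns of `V` are determined by `ω` complex Fourier coefficients, so
`rank V ≤ 2 ω` and `‖V‖_F² ≤ 2 ω ‖V‖₂²`. No layer increases the Frobenius norm by more than the
operator norm of its weights, and by hypothesis `‖φ(V)‖₂` is comparable to
`‖W₂‖₂ ‖W₁‖₂ ‖V‖₂` (`frobNorm_embedMatrix_sq_le`).

For patches of different bands, Parseval's identity makes `u₁, …, uₙ` orthonormal, so that after
normalisation `G = W₁ U` has independent standard Gaussian entries and is independent of `W₂`
(`IsGaussianPair.hasLaw_prod`). The bias centres the hidden layer: `φ(U)` is a multiple of `W₂ X`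
with `X = relu(G) - 1 / √(2π)`. Four estimates hold with exponentially high probability.

* `‖X‖₂ ≲ √m`, because the entries of `X` are centred and sub-Gaussian
  (`hasSubgaussianMGF_relu_sub`), by a union bound over nets of the unit balls
  (`measure_specNorm_gt_le`);
* `‖W₂ X‖₂ ≲ √m √(d + n)` for fixed `X` as above, by the same union bound;
* `‖X‖_F² ≳ m n`, and `‖W₂ X‖_F² ≳ d ‖X‖_F²` for fixed `X`, because a Gaussian rarely falls into
  a short interval (`mgf_neg_sq_le`, `measure_weighted_sum_le`).

Together they give `‖W₂ X‖_F² / ‖W₂ X‖₂² ≳ d n / (d + n)`, which is of the order of `min d n` with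
a universal constant, and `n < m ≤ a₂ d` turns `min d n` into a multiple of `n`.
-/

/-! ### Frobenius norm, operator norm and singular values -/

lemma frobNorm_nonneg {p q : ℕ} (A : Matrix (Fin p) (Fin q) ℝ) : 0 ≤ frobNorm A :=
  Real.sqrt_nonneg _

lemma frobNorm_sq {p q : ℕ} (A : Matrix (Fin p) (Fin q) ℝ) :
    frobNorm A ^ 2 = ∑ i, ∑ j, A i j ^ 2 :=
  Real.sq_sqrt (Finset.sum_nonneg fun _ _ => Finset.sum_nonneg fun _ _ => sq_nonneg _)

lemma specNorm_nonneg {p q : ℕ} (A : Matrix (Fin p) (Fin q) ℝ) : 0 ≤ specNorm A :=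
  norm_nonneg _

lemma norm_toEuclideanLin_le {p q : ℕ} (A : Matrix (Fin p) (Fin q) ℝ)
    (x : EuclideanSpace ℝ (Fin q)) : ‖Matrix.toEuclideanLin A x‖ ≤ specNorm A * ‖x‖ :=
  (Matrix.toEuclideanLin A).toContinuousLinearMap.le_opNorm x

lemma specNorm_le {p q : ℕ} {A : Matrix (Fin p) (Fin q) ℝ} {M : ℝ} (hM : 0 ≤ M)
    (h : ∀ x, ‖Matrix.toEuclideanLin A x‖ ≤ M * ‖x‖) : specNorm A ≤ M :=
  ContinuousLinearMap.opNorm_le_bound _ hM h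

lemma specNorm_smul {p q : ℕ} (c : ℝ) (A : Matrix (Fin p) (Fin q) ℝ) :
    specNorm (c • A) = |c| * specNorm A := by
  simp [specNorm, norm_smul]

lemma frobNorm_smul_sq {p q : ℕ} (c : ℝ) (A : Matrix (Fin p) (Fin q) ℝ) :
    frobNorm (c • A) ^ 2 = c ^ 2 * frobNorm A ^ 2 := by
  simp [frobNorm_sq, mul_pow, Finset.mul_sum]

lemma frobNorm_sq_eq_sum_norm_col {p q : ℕ} (A : Matrix (Fin p) (Fin q) ℝ) :
    frobNorm A ^ 2
      = ∑ j, ‖Matrix.toEuclideanLin A (EuclideanSpace.basisFun (Fin q) ℝ j)‖ ^ 2 := by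
  rw [frobNorm_sq, Finset.sum_comm]
  simp [EuclideanSpace.norm_sq_eq, Matrix.toLpLin_apply]

lemma singVal_nonneg {p q : ℕ} (A : Matrix (Fin p) (Fin q) ℝ) (j : ℕ) : 0 ≤ singVal A j :=
  LinearMap.singularValues_nonneg _ _

lemma sum_sq_singVal {p q : ℕ} (A : Matrix (Fin p) (Fin q) ℝ) :
    ∑ j ∈ Finset.range q, singVal A j ^ 2 = frobNorm A ^ 2 := by
  have hq : Module.finrank ℝ (EuclideanSpace ℝ (Fin q)) = q := by simp
  set T := Matrix.toEuclideanLin A with hT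
  rw [frobNorm_sq_eq_sum_norm_col, Finset.sum_range]
  have h1 : ∀ j : Fin q, singVal A j ^ 2 = T.isSymmetric_adjoint_comp_self.eigenvalues hq j :=
    fun j => T.sq_singularValues_fin hq j
  simp_rw [h1]
  have h2 := T.isSymmetric_adjoint_comp_self.trace_eq_sum_eigenvalues hq
  rw [LinearMap.trace_eq_sum_inner _ (EuclideanSpace.basisFun (Fin q) ℝ)] at h2
  simp only [RCLike.ofReal_real_eq_id, id] at h2
  rw [← h2]
  refine Finset.sum_congr rfl fun j _ => ?_
  rw [LinearMap.comp_apply, LinearMap.adjoint_inner_right, real_inner_self_eq_norm_sq]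

/-- The largest singular value is the operator norm. -/
lemma specNorm_eq_singVal_zero {p q : ℕ} (A : Matrix (Fin p) (Fin q) ℝ) :
    specNorm A = singVal A 0 := by
  have hq : Module.finrank ℝ (EuclideanSpace ℝ (Fin q)) = q := by simp
  set T := Matrix.toEuclideanLin A with hT
  have hS := T.isSymmetric_adjoint_comp_self
  have key : ∀ x, inner ℝ x ((T.adjoint ∘ₗ T) x) = ‖T x‖ ^ 2 := fun x => by
    rw [LinearMap.comp_apply, LinearMap.adjoint_inner_right, real_inner_self_eq_norm_sq]
  apply le_antisymm
  · refine specNorm_le (singVal_nonneg _ _) fun x => ?_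
    refine le_of_sq_le_sq ?_ (mul_nonneg (singVal_nonneg _ _) (norm_nonneg _))
    rw [← hT, ← key, mul_pow, ← (hS.eigenvectorBasis hq).sum_inner_mul_inner,
      ← (hS.eigenvectorBasis hq).sum_sq_norm_inner_right, Finset.mul_sum]
    refine Finset.sum_le_sum fun i _ => ?_
    rw [← hS, hS.apply_eigenvectorBasis, real_inner_smul_left, Real.norm_eq_abs, sq_abs,
      real_inner_comm x]
    have h1 : hS.eigenvalues hq i ≤ singVal A 0 ^ 2 := by
      rw [← T.sq_singularValues_fin hq i]
      exact pow_le_pow_left₀ (T.singularValues_nonneg _)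
        (T.singularValues_antitone (Nat.zero_le _)) 2
    simp only [RCLike.ofReal_real_eq_id, id]
    nlinarith [sq_nonneg (inner ℝ (hS.eigenvectorBasis hq i) x)]
  · rcases Nat.eq_zero_or_pos q with rfl | h0
    · rw [singVal, LinearMap.singularValues_of_finrank_le _ (by simp)]
      exact specNorm_nonneg _
    · obtain ⟨v, hv⟩ := (T.hasEigenvalue_adjoint_comp_self_sq_singularValues
        (n := 0) (by rw [hq]; exact h0)).exists_hasEigenvector
      have h1 := key v
      rw [hv.apply_eq_smul, real_inner_smul_right, real_inner_self_eq_norm_sq, ← mul_pow] at h1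
      have h2 : T.singularValues 0 * ‖v‖ = ‖T v‖ :=
        (pow_left_inj₀ (mul_nonneg (T.singularValues_nonneg _) (norm_nonneg _))
          (norm_nonneg _) two_ne_zero).1 h1
      have h3 : 0 < ‖v‖ := norm_pos_iff.2 hv.2
      have h4 := norm_toEuclideanLin_le A v
      rw [← hT, ← h2] at h4
      exact le_of_mul_le_mul_right h4 h3

lemma singVal_le_specNorm {p q : ℕ} (A : Matrix (Fin p) (Fin q) ℝ) (j : ℕ) :
    singVal A j ≤ specNorm A := by
  rw [specNorm_eq_singVal_zero]
  exact LinearMap.singularValues_antitone _ (Nat.zero_le _)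

lemma singVal_eq_zero {p q : ℕ} {A : Matrix (Fin p) (Fin q) ℝ} {j : ℕ}
    (h : Module.finrank ℝ (LinearMap.range (Matrix.toEuclideanLin A)) ≤ j) : singVal A j = 0 :=
  (LinearMap.singularValues_eq_zero_iff_le_finrank_range _).2 h

lemma finrank_range_toEuclideanLin_le_right {p q : ℕ} (A : Matrix (Fin p) (Fin q) ℝ) :
    Module.finrank ℝ (LinearMap.range (Matrix.toEuclideanLin A)) ≤ q :=
  (LinearMap.finrank_range_le _).trans (by simp)

lemma finrank_range_toEuclideanLin_le_left {p q : ℕ} (A : Matrix (Fin p) (Fin q) ℝ) :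
    Module.finrank ℝ (LinearMap.range (Matrix.toEuclideanLin A)) ≤ p :=
  (Submodule.finrank_le _).trans (by simp)

lemma sum_sq_singVal_of_finrank_le {p q r : ℕ} (A : Matrix (Fin p) (Fin q) ℝ)
    (h : Module.finrank ℝ (LinearMap.range (Matrix.toEuclideanLin A)) ≤ r) :
    ∑ j ∈ Finset.range r, singVal A j ^ 2 = frobNorm A ^ 2 := by
  rw [← sum_sq_singVal]
  have key : ∀ s, Module.finrank ℝ (LinearMap.range (Matrix.toEuclideanLin A)) ≤ s →
      ∑ j ∈ Finset.range (Module.finrank ℝ (LinearMap.range (Matrix.toEuclideanLin A))),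
        singVal A j ^ 2 = ∑ j ∈ Finset.range s, singVal A j ^ 2 := fun s hs => by
    refine Finset.sum_subset (Finset.range_mono hs) fun j _ hj => ?_
    rw [singVal_eq_zero (by simpa using hj)]; simp
  rw [← key r h, ← key q (finrank_range_toEuclideanLin_le_right A)]

lemma frobNorm_sq_le_rank_mul {p q r : ℕ} (A : Matrix (Fin p) (Fin q) ℝ)
    (h : Module.finrank ℝ (LinearMap.range (Matrix.toEuclideanLin A)) ≤ r) :
    frobNorm A ^ 2 ≤ r * specNorm A ^ 2 := by
  rw [← sum_sq_singVal_of_finrank_le A h]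
  refine (Finset.sum_le_card_nsmul _ _ (specNorm A ^ 2) fun j _ => ?_).trans (by simp)
  exact pow_le_pow_left₀ (singVal_nonneg _ _) (singVal_le_specNorm _ _) 2

lemma epsRank_eq_card {p q r : ℕ} (A : Matrix (Fin p) (Fin q) ℝ) {ε : ℝ} (hε : 0 ≤ ε)
    (h : Module.finrank ℝ (LinearMap.range (Matrix.toEuclideanLin A)) ≤ r) :
    epsRank ε A = {j ∈ Finset.range r | ε * specNorm A < singVal A j}.card := by
  rw [epsRank, ← Set.ncard_coe_finset, ← specNorm_eq_singVal_zero]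
  congr 1
  ext j
  simp only [Set.mem_ofPred_eq, Finset.coe_filter, Finset.mem_range]
  refine ⟨fun hj => ⟨?_, hj⟩, fun hj => hj.2⟩
  by_contra hjr
  rw [singVal_eq_zero (h.trans (not_lt.1 hjr))] at hj
  exact absurd hj (not_lt.2 (mul_nonneg hε (specNorm_nonneg _)))

/-- Each singular value counted by the `ε`-rank contributes `ε² ‖A‖₂²` to `‖A‖_F²`. -/
lemma epsRank_mul_le {p q : ℕ} (A : Matrix (Fin p) (Fin q) ℝ) {ε : ℝ} (hε : 0 ≤ ε) :
    epsRank ε A * (ε * specNorm A) ^ 2 ≤ frobNorm A ^ 2 := by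
  rw [epsRank_eq_card A hε (finrank_range_toEuclideanLin_le_right A), ← sum_sq_singVal,
    ← nsmul_eq_mul]
  refine (Finset.card_nsmul_le_sum _ (fun j => singVal A j ^ 2) _ fun j hj => ?_).trans
    (Finset.sum_le_sum_of_subset_of_nonneg (Finset.filter_subset _ _) fun _ _ _ => sq_nonneg _)
  exact pow_le_pow_left₀ (mul_nonneg hε (specNorm_nonneg _)) (Finset.mem_filter.1 hj).2.le 2

/-- The singular values not counted by the `ε`-rank contribute at most `r ε² ‖A‖₂²` to
`‖A‖_F²`. -/
lemma frobNorm_sq_le_epsRank {p q r : ℕ} (A : Matrix (Fin p) (Fin q) ℝ) {ε : ℝ} (hε : 0 ≤ ε)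
    (h : Module.finrank ℝ (LinearMap.range (Matrix.toEuclideanLin A)) ≤ r) :
    frobNorm A ^ 2 ≤ (epsRank ε A + r * ε ^ 2) * specNorm A ^ 2 := by
  rw [epsRank_eq_card A hε h, ← sum_sq_singVal_of_finrank_le A h,
    ← Finset.sum_filter_add_sum_filter_not _ (fun j => ε * specNorm A < singVal A j), add_mul]
  refine add_le_add ?_ ?_
  · rw [← nsmul_eq_mul]
    refine Finset.sum_le_card_nsmul _ _ _ fun j _ => ?_
    exact pow_le_pow_left₀ (singVal_nonneg _ _) (singVal_le_specNorm _ _) 2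
  · rw [mul_assoc, ← mul_pow]
    refine (Finset.sum_le_card_nsmul _ _ ((ε * specNorm A) ^ 2) fun j hj => ?_).trans ?_
    · exact pow_le_pow_left₀ (singVal_nonneg _ _) (not_lt.1 (Finset.mem_filter.1 hj).2) 2
    · rw [nsmul_eq_mul]
      refine mul_le_mul_of_nonneg_right ?_ (sq_nonneg _)
      exact_mod_cast (Finset.card_filter_le _ _).trans (by simp)

/-- A matrix whose Frobenius norm is, up to `κ`, as large as its operator norm and its dimensions
permit has stable rank and `ε`-rank of the order of the smaller dimension. -/
lemma mul_min_le_epsRank_and_stabRank {d n : ℕ} (A : Matrix (Fin d) (Fin n) ℝ) {κ ε : ℝ}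
    (hε : 0 ≤ ε) (hεκ : 2 * ε ^ 2 ≤ κ) (hA : 0 < specNorm A)
    (h : κ * (min d n : ℕ) * specNorm A ^ 2 ≤ frobNorm A ^ 2) :
    κ / 2 * (min d n : ℕ) ≤ epsRank ε A ∧ κ / 2 * (min d n : ℕ) ≤ stabRank A := by
  have hA2 : 0 < specNorm A ^ 2 := by positivity
  have hm : (0 : ℝ) ≤ (min d n : ℕ) := by positivity
  constructor
  · have h1 := h.trans (frobNorm_sq_le_epsRank (r := min d n) A hε
      (le_min (finrank_range_toEuclideanLin_le_left A) (finrank_range_toEuclideanLin_le_right A)))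
    have h2 := le_of_mul_le_mul_right h1 hA2
    nlinarith
  · rw [stabRank, le_div_iff₀ hA2]
    refine le_trans ?_ h
    have : 0 ≤ κ := le_trans (by positivity) hεκ
    have : κ / 2 * (min d n : ℕ) ≤ κ * (min d n : ℕ) := by nlinarith
    nlinarith

lemma frobNorm_mul_le {p q r : ℕ} (A : Matrix (Fin p) (Fin q) ℝ) (B : Matrix (Fin q) (Fin r) ℝ) :
    frobNorm (A * B) ≤ specNorm A * frobNorm B := by
  refine le_of_sq_le_sq ?_ (mul_nonneg (specNorm_nonneg _) (frobNorm_nonneg _))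
  rw [mul_pow, frobNorm_sq_eq_sum_norm_col, frobNorm_sq_eq_sum_norm_col, Finset.mul_sum]
  refine Finset.sum_le_sum fun j _ => ?_
  rw [← mul_pow]
  refine pow_le_pow_left₀ (norm_nonneg _) ?_ 2
  refine le_trans (le_of_eq ?_) (norm_toEuclideanLin_le A _)
  congr 1
  simp [Matrix.toLpLin_apply]

lemma frobNorm_add_le {p q : ℕ} (A B : Matrix (Fin p) (Fin q) ℝ) :
    frobNorm (A + B) ≤ frobNorm A + frobNorm B := by
  have key : ∀ M : Matrix (Fin p) (Fin q) ℝ, frobNorm M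
      = ‖WithLp.toLp 2 (fun e : Fin p × Fin q => M e.1 e.2)‖ := fun M => by
    rw [frobNorm, EuclideanSpace.norm_eq, Fintype.sum_prod_type]; simp
  have h := norm_add_le (WithLp.toLp 2 (fun e : Fin p × Fin q => A e.1 e.2))
    (WithLp.toLp 2 (fun e : Fin p × Fin q => B e.1 e.2))
  rw [← key, ← key, ← WithLp.toLp_add] at h
  exact (key (A + B)).trans_le h

lemma abs_relu_le (t : ℝ) : |relu t| ≤ |t| := by
  unfold relu
  rcases le_total t 0 with h | h <;> simp [h]

lemma frobNorm_map_relu_le {p q : ℕ} (A : Matrix (Fin p) (Fin q) ℝ) :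
    frobNorm (A.map relu) ≤ frobNorm A := by
  refine Real.sqrt_le_sqrt (Finset.sum_le_sum fun i _ => Finset.sum_le_sum fun j _ => ?_)
  exact sq_le_sq.2 (abs_relu_le _)

lemma embedMatrix_eq {k m d n : ℕ} (W₁ : Matrix (Fin m) (Fin k) ℝ) (W₂ : Matrix (Fin d) (Fin m) ℝ)
    (b : Fin d → ℝ) (X : Matrix (Fin k) (Fin n) ℝ) :
    embedMatrix W₁ W₂ b X = W₂ * (W₁ * X).map relu + Matrix.vecMulVec b (fun _ => 1) := by
  ext r i
  simp [embedMatrix, embed, Matrix.vecMulVec_apply, Matrix.mul_apply, Matrix.mulVec, dotProduct]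

/-! ### Fourier supports and patches of one band -/

lemma patchDFT_apply {k : ℕ} [NeZero k] (x : EuclideanSpace ℝ (Fin k)) (j : Fin k) :
    patchDFT x j = ∑ t : ZMod k, ZMod.stdAddChar (-(t * ZMod.finEquiv k j)) *
      (x ((ZMod.finEquiv k).symm t) : ℂ) := by
  simp [patchDFT, ZMod.dft_apply]

/-- The discrete Fourier transform of real patches as an `ℝ`-linear map. -/
noncomputable def patchDFTLinear (k : ℕ) [NeZero k] :
    EuclideanSpace ℝ (Fin k) →ₗ[ℝ] (Fin k → ℂ) where
  toFun := patchDFT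
  map_add' x y := by
    ext j
    simp [patchDFT_apply, mul_add, Finset.sum_add_distrib]
  map_smul' c x := by
    ext j
    simp only [patchDFT_apply, PiLp.smul_apply, smul_eq_mul, Complex.ofReal_mul, RingHom.id_apply,
      Pi.smul_apply, Complex.real_smul, Finset.mul_sum]
    exact Finset.sum_congr rfl fun _ _ => by ring

lemma patchDFT_injective {k : ℕ} [NeZero k] :
    Function.Injective (patchDFT : EuclideanSpace ℝ (Fin k) → Fin k → ℂ) := by
  intro x y h
  have h1 : ZMod.dft (fun t : ZMod k => (x ((ZMod.finEquiv k).symm t) : ℂ))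
      = ZMod.dft (fun t : ZMod k => (y ((ZMod.finEquiv k).symm t) : ℂ)) := by
    ext t
    simpa [patchDFT] using congrFun h ((ZMod.finEquiv k).symm t)
  ext i
  simpa using congrFun (ZMod.dft.injective h1) (ZMod.finEquiv k i)

/-- Real patches supported in one band `B` span a space of real dimension at most `2 |B|`: their
transforms are determined by `|B|` complex numbers. -/
lemma finrank_range_patchMatrix_le {k n : ℕ} [NeZero k] (v : Fin n → EuclideanSpace ℝ (Fin k))
    (B : Finset (Fin k)) (hv : ∀ i, SupportedInBand (v i) B) :
    Module.finrank ℝ (LinearMap.range (Matrix.toEuclideanLin (patchMatrix v))) ≤ 2 * B.card := by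
  set R := LinearMap.range (Matrix.toEuclideanLin (patchMatrix v)) with hR
  let res : (Fin k → ℂ) →ₗ[ℝ] (B → ℂ) :=
    { toFun := fun f b => f b, map_add' := fun _ _ => rfl, map_smul' := fun _ _ => rfl }
  have hsupp : ∀ x ∈ R, ∀ j ∉ B, patchDFTLinear k x j = 0 := by
    rintro _ ⟨z, rfl⟩ j hj
    have hz : Matrix.toEuclideanLin (patchMatrix v) z = ∑ i, z i • v i := by
      ext t
      simp [Matrix.toLpLin_apply, patchMatrix, Matrix.mulVec, dotProduct, mul_comm]
    rw [hz, map_sum, Finset.sum_apply]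
    refine Finset.sum_eq_zero fun i _ => ?_
    have : patchDFT (v i) j = 0 := by
      by_contra h0
      exact hj (hv i h0)
    rw [map_smul]
    change z i • patchDFT (v i) j = 0
    rw [this, smul_zero]
  have hinj : Function.Injective (res ∘ₗ patchDFTLinear k ∘ₗ R.subtype) := by
    rw [injective_iff_map_eq_zero]
    intro x hx
    have h0 : patchDFTLinear k x = patchDFTLinear k 0 := by
      rw [map_zero]
      ext j
      by_cases hj : j ∈ B
      · exact congrFun hx ⟨j, hj⟩
      · exact hsupp x x.2 j hj
    exact Subtype.ext (patchDFT_injective h0)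
  refine (LinearMap.finrank_le_finrank_of_injective hinj).trans (le_of_eq ?_)
  rw [Module.finrank_pi_fintype]
  simp [mul_comm]

lemma conj_patchDFT {k : ℕ} [NeZero k] (x : EuclideanSpace ℝ (Fin k)) (j : Fin k) :
    (starRingEnd ℂ) (patchDFT x j) = ∑ t : ZMod k, ZMod.stdAddChar (t * ZMod.finEquiv k j) *
      (x ((ZMod.finEquiv k).symm t) : ℂ) := by
  rw [patchDFT_apply, map_sum]
  refine Finset.sum_congr rfl fun t _ => ?_
  rw [map_mul, Complex.conj_ofReal, ← AddChar.map_neg_eq_conj, neg_neg]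

/-- Parseval's identity for the discrete Fourier transform of real patches. -/
lemma sum_conj_patchDFT_mul {k : ℕ} [NeZero k] (x y : EuclideanSpace ℝ (Fin k)) :
    ∑ j, (starRingEnd ℂ) (patchDFT x j) * patchDFT y j = k * (inner ℝ x y : ℝ) := by
  have hinv : ∀ t : ZMod k, ∑ j : ZMod k, ZMod.stdAddChar (j * t) *
      patchDFT y ((ZMod.finEquiv k).symm j) = k * (y ((ZMod.finEquiv k).symm t) : ℂ) := fun t => by
    have h := ZMod.invDFT_apply
      (ZMod.dft (fun t : ZMod k => (y ((ZMod.finEquiv k).symm t) : ℂ))) t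
    rw [LinearEquiv.symm_apply_apply] at h
    rw [h]
    have hk : (k : ℂ) ≠ 0 := NeZero.ne _
    simp [patchDFT, hk]
  have h1 : ∀ j, (starRingEnd ℂ) (patchDFT x j) * patchDFT y j = ∑ t : ZMod k,
      (x ((ZMod.finEquiv k).symm t) : ℂ) *
        (ZMod.stdAddChar (ZMod.finEquiv k j * t) * patchDFT y j) := fun j => by
    rw [conj_patchDFT, Finset.sum_mul]
    exact Finset.sum_congr rfl fun t _ => by rw [mul_comm t]; ring
  simp_rw [h1]
  rw [Finset.sum_comm]
  simp_rw [← Finset.mul_sum]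
  have h2 : ∀ t : ZMod k, ∑ j, ZMod.stdAddChar (ZMod.finEquiv k j * t) * patchDFT y j
      = k * (y ((ZMod.finEquiv k).symm t) : ℂ) := fun t => by
    rw [← hinv t]
    exact Fintype.sum_equiv (ZMod.finEquiv k).toEquiv _ _ fun j => by simp
  simp_rw [h2]
  rw [PiLp.inner_apply]
  push_cast
  rw [Finset.mul_sum]
  refine (Fintype.sum_equiv (ZMod.finEquiv k).toEquiv _ _ fun j => ?_).symm
  simp
  ring

lemma inner_eq_zero_of_supportedInBand {k : ℕ} [NeZero k] {x y : EuclideanSpace ℝ (Fin k)}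
    {B B' : Finset (Fin k)} (hx : SupportedInBand x B) (hy : SupportedInBand y B')
    (h : Disjoint B B') : inner ℝ x y = 0 := by
  have h1 := sum_conj_patchDFT_mul x y
  rw [Finset.sum_eq_zero fun j _ => ?_] at h1
  · simpa [NeZero.ne k] using h1.symm
  · by_cases hj : patchDFT x j = 0
    · simp [hj]
    · have hj' : patchDFT y j = 0 := by
        by_contra h0
        exact Finset.disjoint_left.1 h (hx hj) (hy h0)
      simp [hj']

/-- Patches from one band: the columns span a space of dimension at most `2 ω`, so
`‖V‖_F² ≤ 2 ω ‖V‖₂²`. The Frobenius norm of the embedding exceeds that of `V` by at most the factor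
`(1 + C₀) ‖W₂‖₂ ‖W₁‖₂`, while by hypothesis its operator norm keeps up with `‖W₂‖₂ ‖W₁‖₂ ‖V‖₂`. -/
lemma frobNorm_embedMatrix_sq_le {k n m d : ℕ} [NeZero k] {ω c₀ C₀ : ℝ} (hc : 0 < c₀)
    (hC : 0 < C₀) {B : Finset (Fin k)} (hB : (B.card : ℝ) ≤ ω)
    (v : Fin n → EuclideanSpace ℝ (Fin k)) (hv : ∀ i, SupportedInBand (v i) B)
    (W₁ : Matrix (Fin m) (Fin k) ℝ) (W₂ : Matrix (Fin d) (Fin m) ℝ) (b : Fin d → ℝ)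
    (h₁ : c₀ * (specNorm W₂ * specNorm W₁ * specNorm (patchMatrix v))
      ≤ specNorm (embedMatrix W₁ W₂ b (patchMatrix v)))
    (h₂ : frobNorm (Matrix.vecMulVec b (fun _ : Fin n => (1 : ℝ)))
      ≤ C₀ * frobNorm (W₂ * (W₁ * patchMatrix v).map relu)) :
    frobNorm (embedMatrix W₁ W₂ b (patchMatrix v)) ^ 2
      ≤ 2 * ((1 + C₀) / c₀) ^ 2 * ω * specNorm (embedMatrix W₁ W₂ b (patchMatrix v)) ^ 2 := by
  set V := patchMatrix v
  set Φ := embedMatrix W₁ W₂ b V with hΦ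
  have hω : 0 ≤ ω := le_trans (by positivity) hB
  have e1 : frobNorm Φ ≤ (1 + C₀) * (specNorm W₂ * (specNorm W₁ * frobNorm V)) := by
    rw [hΦ, embedMatrix_eq]
    refine (frobNorm_add_le _ _).trans ?_
    have e2 : frobNorm (W₂ * (W₁ * V).map relu) ≤ specNorm W₂ * (specNorm W₁ * frobNorm V) :=
      (frobNorm_mul_le _ _).trans (mul_le_mul_of_nonneg_left
        ((frobNorm_map_relu_le _).trans (frobNorm_mul_le _ _)) (specNorm_nonneg _))
    nlinarith
  have e3 : frobNorm V ^ 2 ≤ 2 * ω * specNorm V ^ 2 := by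
    refine (frobNorm_sq_le_rank_mul V (finrank_range_patchMatrix_le v B hv)).trans ?_
    push_cast
    gcongr
  calc frobNorm Φ ^ 2
      ≤ ((1 + C₀) * (specNorm W₂ * (specNorm W₁ * frobNorm V))) ^ 2 :=
        pow_le_pow_left₀ (frobNorm_nonneg _) e1 2
    _ = ((1 + C₀) * (specNorm W₂ * specNorm W₁)) ^ 2 * frobNorm V ^ 2 := by ring
    _ ≤ ((1 + C₀) * (specNorm W₂ * specNorm W₁)) ^ 2 * (2 * ω * specNorm V ^ 2) := by gcongr
    _ = 2 * ((1 + C₀) / c₀) ^ 2 * ω * (c₀ * (specNorm W₂ * specNorm W₁ * specNorm V)) ^ 2 := by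
        field_simp
    _ ≤ _ := by
        have : 0 ≤ c₀ * (specNorm W₂ * specNorm W₁ * specNorm V) := by
          have := specNorm_nonneg W₂
          have := specNorm_nonneg W₁
          have := specNorm_nonneg V
          positivity
        gcongr

lemma epsRank_le_and_stabRank_le {p q : ℕ} {A : Matrix (Fin p) (Fin q) ℝ} {M : ℝ} (hM : 0 ≤ M)
    (h : frobNorm A ^ 2 ≤ M * specNorm A ^ 2) :
    (∀ ε : ℝ, 0 < ε → (epsRank ε A : ℝ) ≤ M * (ε ^ 2)⁻¹) ∧ stabRank A ≤ M := by
  rcases (specNorm_nonneg A).eq_or_lt with h0 | h0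
  · constructor
    · intro ε hε
      have : epsRank ε A = 0 := by
        rw [epsRank_eq_card A hε.le le_rfl, Finset.card_eq_zero, Finset.filter_eq_empty_iff]
        intro j _
        rw [not_lt, ← h0, mul_zero, h0]
        exact singVal_le_specNorm A j
      rw [this, Nat.cast_zero]; positivity
    · rw [stabRank, ← h0]
      simpa using hM
  · constructor
    · intro ε hε
      rw [← div_eq_mul_inv, le_div_iff₀ (by positivity)]
      have h1 := (epsRank_mul_le A hε.le).trans h
      rw [mul_pow, ← mul_assoc] at h1
      exact le_of_mul_le_mul_right h1 (by positivity)
    · rw [stabRank]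
      exact div_le_of_le_mul₀ (by positivity) hM h

/-! ### Half-nets and sub-Gaussian matrices -/

/-- The closed unit ball has a `1/2`-net with at most `5 ^ n` points: half of a maximal
`1`-separated subset of the ball of radius `2`. -/
lemma exists_half_net (n : ℕ) : ∃ N : Finset (EuclideanSpace ℝ (Fin n)),
    N.card ≤ 5 ^ n ∧ (∀ y ∈ N, ‖y‖ ≤ 1) ∧
      ∀ x : EuclideanSpace ℝ (Fin n), ‖x‖ ≤ 1 → ∃ y ∈ N, ‖x - y‖ ≤ 1 / 2 := by
  classical
  let Sep : Finset (EuclideanSpace ℝ (Fin n)) → Prop := fun s =>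
    (∀ c ∈ s, ‖c‖ ≤ 2) ∧ ∀ c ∈ s, ∀ d ∈ s, c ≠ d → 1 ≤ ‖c - d‖
  have hcard : ∀ s, Sep s → s.card ≤ 5 ^ n := fun s hs => by
    simpa using Besicovitch.card_le_of_separated s hs.1 hs.2
  let Q : ℕ → Prop := fun j => ∃ s, Sep s ∧ s.card = j
  obtain ⟨s, hs, hsj⟩ : Q (Nat.findGreatest Q (5 ^ n)) :=
    Nat.findGreatest_spec (Nat.zero_le _) (P := Q) ⟨∅, by simp [Sep], rfl⟩
  have hmax : ∀ s', Sep s' → s'.card ≤ s.card := fun s' hs' => by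
    rw [hsj]
    exact Nat.le_findGreatest (hcard s' hs') ⟨s', hs', rfl⟩
  refine ⟨s.image fun c => (1 / 2 : ℝ) • c, Finset.card_image_le.trans (hcard s hs), ?_, ?_⟩
  · intro y hy
    obtain ⟨c, hc, rfl⟩ := Finset.mem_image.1 hy
    rw [norm_smul]
    norm_num
    linarith [hs.1 c hc]
  · intro x hx
    obtain ⟨c, hc, hxc⟩ : ∃ c ∈ s, ‖(2 : ℝ) • x - c‖ < 1 := by
      by_contra! h
      have hx2 : (2 : ℝ) • x ∉ s := fun hmem => by
        have := h _ hmem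
        rw [sub_self, norm_zero] at this
        linarith
      have hins : Sep (insert ((2 : ℝ) • x) s) := by
        constructor
        · intro c hc
          rcases Finset.mem_insert.1 hc with rfl | hc
          · rw [norm_smul]; norm_num; exact hx
          · exact hs.1 c hc
        · intro c hc d hd hcd
          rcases Finset.mem_insert.1 hc with rfl | hc <;>
            rcases Finset.mem_insert.1 hd with rfl | hd
          · exact absurd rfl hcd
          · exact h d hd
          · rw [norm_sub_rev]; exact h c hc
          · exact hs.2 c hc d hd hcd
      have := hmax _ hins
      rw [Finset.card_insert_of_notMem hx2] at this
      omega
    refine ⟨_, Finset.mem_image_of_mem _ hc, ?_⟩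
    have : x - (1 / 2 : ℝ) • c = (1 / 2 : ℝ) • ((2 : ℝ) • x - c) := by
      rw [smul_sub, smul_smul]; norm_num
    rw [this, norm_smul]
    norm_num
    linarith

lemma norm_le_two_mul_of_half_net {n : ℕ} {N : Finset (EuclideanSpace ℝ (Fin n))}
    (hN : ∀ x : EuclideanSpace ℝ (Fin n), ‖x‖ ≤ 1 → ∃ y ∈ N, ‖x - y‖ ≤ 1 / 2)
    {x : EuclideanSpace ℝ (Fin n)} {t : ℝ} (ht : 0 ≤ t) (h : ∀ y ∈ N, inner ℝ y x ≤ t) :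
    ‖x‖ ≤ 2 * t := by
  rcases eq_or_ne x 0 with rfl | hx
  · simpa using ht
  have hx0 : ‖x‖ ≠ 0 := norm_ne_zero_iff.2 hx
  obtain ⟨y, hy, hxy⟩ := hN (‖x‖⁻¹ • x) (by rw [norm_smul, norm_inv, norm_norm,
    inv_mul_cancel₀ hx0])
  have h1 : inner ℝ (‖x‖⁻¹ • x) x = ‖x‖ := by
    rw [real_inner_smul_left, real_inner_self_eq_norm_sq]
    field_simp
  have h2 : inner ℝ (‖x‖⁻¹ • x - y) x ≤ 1 / 2 * ‖x‖ :=
    (real_inner_le_norm _ _).trans (mul_le_mul_of_nonneg_right hxy (norm_nonneg _))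
  rw [inner_sub_left, h1] at h2
  linarith [h y hy]

/-- The operator norm is controlled by the bilinear form on half-nets of the two unit balls. -/
lemma specNorm_le_of_half_net {p q : ℕ} {N : Finset (EuclideanSpace ℝ (Fin p))}
    {N' : Finset (EuclideanSpace ℝ (Fin q))}
    (hN : ∀ x : EuclideanSpace ℝ (Fin p), ‖x‖ ≤ 1 → ∃ y ∈ N, ‖x - y‖ ≤ 1 / 2)
    (hN' : ∀ x : EuclideanSpace ℝ (Fin q), ‖x‖ ≤ 1 → ∃ y ∈ N', ‖x - y‖ ≤ 1 / 2)
    {A : Matrix (Fin p) (Fin q) ℝ} {t : ℝ} (ht : 0 ≤ t)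
    (h : ∀ y ∈ N, ∀ z ∈ N', inner ℝ y (Matrix.toEuclideanLin A z) ≤ t) :
    specNorm A ≤ 4 * t := by
  have hA := specNorm_nonneg A
  suffices specNorm A ≤ 2 * t + specNorm A / 2 by linarith
  refine specNorm_le (by positivity) fun x => ?_
  rcases eq_or_ne x 0 with rfl | hx
  · simp
  have hx0 : 0 < ‖x‖ := norm_pos_iff.2 hx
  have hunit : ∀ x : EuclideanSpace ℝ (Fin q), ‖x‖ ≤ 1 →
      ‖Matrix.toEuclideanLin A x‖ ≤ 2 * t + specNorm A / 2 := fun x hx => by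
    obtain ⟨z, hz, hxz⟩ := hN' x hx
    have h1 := norm_le_two_mul_of_half_net hN ht (fun y hy => h y hy z hz)
    have h2 := norm_toEuclideanLin_le A (x - z)
    rw [map_sub] at h2
    have h3 := norm_sub_norm_le (Matrix.toEuclideanLin A x) (Matrix.toEuclideanLin A z)
    nlinarith
  have h4 := hunit (‖x‖⁻¹ • x) (by rw [norm_smul, norm_inv, norm_norm, inv_mul_cancel₀ hx0.ne'])
  rw [map_smul, norm_smul, norm_inv, norm_norm, inv_mul_le_iff₀ hx0] at h4
  linarith

lemma inner_toEuclideanLin {p q : ℕ} (A : Matrix (Fin p) (Fin q) ℝ) (y : EuclideanSpace ℝ (Fin p))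
    (z : EuclideanSpace ℝ (Fin q)) :
    inner ℝ y (Matrix.toEuclideanLin A z) = ∑ e : Fin p × Fin q, y e.1 * z e.2 * A e.1 e.2 := by
  rw [PiLp.inner_apply, Fintype.sum_prod_type]
  refine Finset.sum_congr rfl fun i _ => ?_
  simp only [Matrix.toLpLin_apply, Matrix.mulVec, dotProduct, RCLike.inner_apply, conj_trivial,
    Finset.sum_mul]
  exact Finset.sum_congr rfl fun j _ => by ring

section Subgaussian

variable {Ω : Type*} [MeasurableSpace Ω] {μ : Measure Ω}

lemma ProbabilityTheory.HasSubgaussianMGF.mono {X : Ω → ℝ} {c c' : ℝ≥0}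
    (h : HasSubgaussianMGF X c μ) (hc : c ≤ c') : HasSubgaussianMGF X c' μ where
  integrable_exp_mul := h.integrable_exp_mul
  mgf_le t := (h.mgf_le t).trans (Real.exp_le_exp.2 (by
    have : (c : ℝ) ≤ c' := hc
    gcongr))

lemma hasSubgaussianMGF_sum_mul {ι : Type*} [Fintype ι] {X : ι → Ω → ℝ} (hX : iIndepFun X μ)
    {c S : ℝ≥0} (hc : ∀ e, HasSubgaussianMGF (X e) c μ) {a : ι → ℝ} (ha : ∑ e, a e ^ 2 ≤ S) :
    HasSubgaussianMGF (fun w => ∑ e, a e * X e w) (S * c) μ := by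
  have hind : iIndepFun (fun e w => a e * X e w) μ :=
    hX.comp (fun e x => a e * x) (fun e => measurable_const_mul _)
  have hsub : ∀ e, HasSubgaussianMGF (fun w => a e * X e w) ((a e ^ 2).toNNReal * c) μ :=
    fun e => ((hc e).const_mul (a e)).mono (mul_le_mul_of_nonneg_right
      (NNReal.coe_le_coe.1 (Real.le_coe_toNNReal _)) zero_le)
  refine (HasSubgaussianMGF.sum_of_iIndepFun hind (s := Finset.univ) fun e _ => hsub e).mono ?_
  rw [← Finset.sum_mul]
  refine mul_le_mul_of_nonneg_right ?_ zero_le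
  rw [← NNReal.coe_le_coe]
  push_cast
  simpa [Real.coe_toNNReal, sq_nonneg] using ha

/-- A random matrix whose bilinear form is sub-Gaussian with parameter `c` on unit vectors has
operator norm of order `√(c (p + q))`, up to an exponentially small probability. -/
lemma measure_specNorm_gt_le [IsFiniteMeasure μ] {p q : ℕ} {M : Ω → Matrix (Fin p) (Fin q) ℝ}
    {c : ℝ≥0}
    (hM : ∀ (y : EuclideanSpace ℝ (Fin p)) (z : EuclideanSpace ℝ (Fin q)), ‖y‖ ≤ 1 → ‖z‖ ≤ 1 →
      HasSubgaussianMGF (fun w => inner ℝ y (Matrix.toEuclideanLin (M w) z)) c μ)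
    {t : ℝ} (ht : 0 ≤ t) :
    μ.real {w | 4 * t < specNorm (M w)} ≤ 5 ^ (p + q) * Real.exp (-t ^ 2 / (2 * c)) := by
  obtain ⟨N, hNc, hN1, hN⟩ := exists_half_net p
  obtain ⟨N', hNc', hN1', hN'⟩ := exists_half_net q
  have hsub : {w | 4 * t < specNorm (M w)} ⊆ ⋃ e ∈ N ×ˢ N',
      {w | t ≤ inner ℝ e.1 (Matrix.toEuclideanLin (M w) e.2)} := by
    intro w hw
    by_contra hcon
    simp only [Set.mem_iUnion, not_exists] at hcon
    refine absurd (specNorm_le_of_half_net hN hN' ht fun y hy z hz => ?_) (not_le.2 hw)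
    have := hcon (y, z) (Finset.mk_mem_product hy hz)
    exact (not_le.1 this).le
  refine (measureReal_mono hsub (measure_ne_top _ _)).trans
    ((measureReal_biUnion_finset_le _ _).trans ?_)
  refine (Finset.sum_le_card_nsmul _ _ (Real.exp (-t ^ 2 / (2 * c))) fun e he => ?_).trans ?_
  · rw [Finset.mem_product] at he
    exact (hM e.1 e.2 (hN1 _ he.1) (hN1' _ he.2)).measure_ge_le ht
  · rw [nsmul_eq_mul, Finset.card_product, pow_add]
    refine mul_le_mul_of_nonneg_right ?_ (Real.exp_nonneg _)
    exact_mod_cast Nat.mul_le_mul hNc hNc'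

end Subgaussian

lemma hasSubgaussianMGF_id_gaussianReal : HasSubgaussianMGF id 1 (gaussianReal 0 1) where
  integrable_exp_mul t := integrable_exp_mul_gaussianReal t
  mgf_le t := by rw [mgf_id_gaussianReal]; simp

lemma measurable_relu : Measurable relu := measurable_id.max measurable_const

lemma integrable_exp_mul_relu (t : ℝ) :
    Integrable (fun x => Real.exp (t * relu x)) (gaussianReal 0 1) := by
  refine Integrable.mono' ((integrable_exp_mul_gaussianReal (μ := 0) (v := 1) t).add
    (integrable_const 1)) (by have := measurable_relu; fun_prop) (ae_of_all _ fun x => ?_)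
  rw [Real.norm_eq_abs, Real.abs_exp]
  simp only [relu, Pi.add_apply]
  rcases le_total x 0 with h | h
  · simp [h, Real.exp_nonneg]
  · simp [h]

lemma integral_relu_gaussianReal : ∫ x, relu x ∂(gaussianReal 0 1) = 1 / √(2 * Real.pi) := by
  rw [integral_gaussianReal_eq_integral_smul one_ne_zero]
  have h1 : (fun x => gaussianPDFReal 0 1 x • relu x) = Set.indicator (Set.Ioi (0 : ℝ))
      (fun x => (√(2 * Real.pi))⁻¹ * (x ^ (1 : ℝ) * Real.exp (-(1 / 2) * x ^ (2 : ℝ)))) := by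
    ext x
    by_cases hx : 0 < x
    · rw [Set.indicator_of_mem (Set.mem_Ioi.2 hx)]
      simp only [gaussianPDFReal, relu, max_eq_left hx.le, smul_eq_mul]
      norm_num
      ring_nf
    · rw [Set.indicator_of_notMem (by simpa using hx)]
      simp [relu, max_eq_right (not_lt.1 hx)]
  rw [h1, integral_indicator measurableSet_Ioi, integral_const_mul,
    integral_rpow_mul_exp_neg_mul_rpow (by norm_num) (by norm_num) (by norm_num)]
  norm_num

/-- The centred rectified Gaussian is sub-Gaussian. With `A = 𝔼 exp (t relu g)` and
`B = 𝔼 exp (-t relu g)`, Jensen's inequality bounds the centring factor by `B`, and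
`A B ≤ ((A + B) / 2)²`, where `(A + B) / 2 = 𝔼 cosh (t relu g) ≤ 𝔼 cosh (t g)`. -/
lemma hasSubgaussianMGF_relu_sub :
    HasSubgaussianMGF (fun x => relu x - 1 / √(2 * Real.pi)) 2 (gaussianReal 0 1) where
  integrable_exp_mul t := by
    simp_rw [mul_sub, Real.exp_sub]
    exact (integrable_exp_mul_relu t).div_const _
  mgf_le t := by
    have hint : Integrable relu (gaussianReal 0 1) := by
      refine Integrable.mono' ((memLp_id_gaussianReal (μ := 0) (v := 1) 1).integrable
        (by simp)).norm measurable_relu.aestronglyMeasurable (ae_of_all _ fun x => ?_)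
      exact abs_relu_le x
    set A := ∫ x, Real.exp (t * relu x) ∂(gaussianReal 0 1) with hA
    set B := ∫ x, Real.exp (-t * relu x) ∂(gaussianReal 0 1) with hB
    have hJ : Real.exp (-t * (1 / √(2 * Real.pi))) ≤ B := by
      have h := convexOn_exp.map_integral_le (μ := gaussianReal 0 1)
        (f := fun x => -t * relu x) Real.continuous_exp.continuousOn isClosed_univ (by simp)
        (hint.const_mul _) (integrable_exp_mul_relu (-t))
      rwa [integral_const_mul, integral_relu_gaussianReal] at h
    have hA0 : 0 ≤ A := integral_nonneg fun _ => Real.exp_nonneg _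
    have hM : ∀ s : ℝ, ∫ x, Real.exp (s * x) ∂(gaussianReal 0 1) = Real.exp (s ^ 2 / 2) :=
      fun s => by
        have := congrFun (mgf_fun_id_gaussianReal (μ := 0) (v := 1)) s
        simpa [mgf] using this
    have hAB : A + B ≤ 2 * Real.exp (t ^ 2 / 2) := by
      have e1 : 2 * Real.exp (t ^ 2 / 2) = ∫ x, (Real.exp (t * x) + Real.exp (-t * x))
          ∂(gaussianReal 0 1) := by
        rw [integral_add (integrable_exp_mul_gaussianReal t) (integrable_exp_mul_gaussianReal (-t)),
          hM, hM]
        ring_nf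
      rw [e1, hA, hB, ← integral_add (integrable_exp_mul_relu t) (integrable_exp_mul_relu (-t))]
      refine integral_mono ((integrable_exp_mul_relu t).add (integrable_exp_mul_relu (-t)))
        ((integrable_exp_mul_gaussianReal t).add (integrable_exp_mul_gaussianReal (-t)))
        fun x => ?_
      have hcosh : ∀ y : ℝ, Real.exp (t * y) + Real.exp (-t * y) = 2 * Real.cosh (t * y) :=
        fun y => by rw [Real.cosh_eq]; ring_nf
      simp only
      rw [hcosh, hcosh]
      gcongr
      rw [Real.cosh_le_cosh, abs_mul, abs_mul]
      exact mul_le_mul_of_nonneg_left (abs_relu_le x) (abs_nonneg _)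
    have hmgf : mgf (fun x => relu x - 1 / √(2 * Real.pi)) (gaussianReal 0 1) t
        = A * Real.exp (-t * (1 / √(2 * Real.pi))) := by
      rw [mgf, hA, ← integral_mul_const]
      congr 1
      ext x
      rw [← Real.exp_add]
      ring_nf
    rw [hmgf]
    have hB0 : 0 ≤ B := integral_nonneg fun _ => Real.exp_nonneg _
    calc A * Real.exp (-t * (1 / √(2 * Real.pi))) ≤ A * B := by gcongr
      _ ≤ ((A + B) / 2) ^ 2 := by nlinarith [sq_nonneg (A - B)]
      _ ≤ (Real.exp (t ^ 2 / 2)) ^ 2 := by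
          refine pow_le_pow_left₀ (by positivity) (by linarith) 2
      _ = Real.exp ((2 : ℝ≥0) * t ^ 2 / 2) := by
          rw [← Real.exp_nat_mul]; push_cast; ring_nf

/-! ### Lower tails and families of standard Gaussians -/

/-- A standard Gaussian variable lies in an interval of radius `τ` with probability at most `τ`. -/
lemma gaussianReal_real_Icc_le (a : ℝ) {τ : ℝ} (hτ : 0 ≤ τ) :
    (gaussianReal 0 1).real (Set.Icc (a - τ) (a + τ)) ≤ τ := by
  rw [Measure.real, gaussianReal_apply_eq_integral _ one_ne_zero, ENNReal.toReal_ofReal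
    (integral_nonneg fun x => gaussianPDFReal_nonneg _ _ _)]
  have hb : ∀ x, gaussianPDFReal 0 1 x ≤ 1 / 2 := fun x => by
    have h1 : (2 : ℝ) ≤ √(2 * Real.pi * (1 : ℝ≥0)) := by
      refine Real.le_sqrt_of_sq_le ?_
      have := Real.pi_gt_three
      push_cast
      linarith
    have h2 : (√(2 * Real.pi * (1 : ℝ≥0)))⁻¹ ≤ 1 / 2 := by
      rw [one_div]
      gcongr
    have h3 : Real.exp (-(x - 0) ^ 2 / (2 * (1 : ℝ≥0))) ≤ 1 := by
      rw [Real.exp_le_one_iff]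
      have := sq_nonneg (x - 0)
      push_cast
      linarith
    calc gaussianPDFReal 0 1 x ≤ 1 / 2 * 1 := mul_le_mul h2 h3 (Real.exp_nonneg _) (by norm_num)
      _ = 1 / 2 := by ring
  have h := norm_setIntegral_le_of_norm_le_const (μ := volume) (s := Set.Icc (a - τ) (a + τ))
    (f := gaussianPDFReal 0 1) (C := 1 / 2) (by simp) (fun x _ => by
      rw [Real.norm_eq_abs, abs_of_nonneg (gaussianPDFReal_nonneg _ _ _)]; exact hb x)
  refine (le_abs_self _).trans (h.trans ?_)
  rw [Measure.real, Real.volume_Icc, ENNReal.toReal_ofReal (by linarith)]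
  linarith

/-- If `|f g| ≤ τ` forces the Gaussian `g` into an interval of radius `τ`, then the Laplace
transform of `f(g)²` is small at large arguments. -/
lemma mgf_neg_sq_le {f : ℝ → ℝ} {a τ l : ℝ} (hτ : 0 ≤ τ) (hl : 0 ≤ l)
    (hfa : ∀ x, |f x| ≤ τ → x ∈ Set.Icc (a - τ) (a + τ)) :
    mgf (fun x => f x ^ 2) (gaussianReal 0 1) (-l) ≤ τ + Real.exp (-l * τ ^ 2) := by
  have hle : ∀ x, Real.exp (-l * f x ^ 2)
      ≤ (Set.Icc (a - τ) (a + τ)).indicator 1 x + Real.exp (-l * τ ^ 2) := fun x => by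
    by_cases hx : |f x| ≤ τ
    · rw [Set.indicator_of_mem (hfa x hx)]
      have : Real.exp (-l * f x ^ 2) ≤ 1 := by
        rw [Real.exp_le_one_iff]; nlinarith [sq_nonneg (f x)]
      simp only [Pi.one_apply]
      linarith [Real.exp_nonneg (-l * τ ^ 2)]
    · have h1 : τ ^ 2 ≤ f x ^ 2 := by
        rw [← sq_abs (f x)]
        exact pow_le_pow_left₀ hτ (not_le.1 hx).le 2
      have h2 : Real.exp (-l * f x ^ 2) ≤ Real.exp (-l * τ ^ 2) :=
        Real.exp_le_exp.2 (by nlinarith)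
      have h3 : (0 : ℝ) ≤ (Set.Icc (a - τ) (a + τ)).indicator 1 x :=
        Set.indicator_nonneg (fun _ _ => zero_le_one) _
      linarith
  have hind : Integrable ((Set.Icc (a - τ) (a + τ)).indicator (1 : ℝ → ℝ)) (gaussianReal 0 1) :=
    (integrable_const (1 : ℝ)).indicator measurableSet_Icc
  calc mgf (fun x => f x ^ 2) (gaussianReal 0 1) (-l)
      ≤ ∫ x, ((Set.Icc (a - τ) (a + τ)).indicator 1 x + Real.exp (-l * τ ^ 2))
          ∂(gaussianReal 0 1) :=
        integral_mono_of_nonneg (ae_of_all _ fun _ => Real.exp_nonneg _)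
          (hind.add (integrable_const _)) (ae_of_all _ hle)
    _ ≤ τ + Real.exp (-l * τ ^ 2) := by
        rw [integral_add hind (integrable_const _), integral_indicator_one measurableSet_Icc]
        simpa using gaussianReal_real_Icc_le a hτ

/-- Lower tail for a weighted sum `∑ i, q i ∑ r, Z i r` in which only the variables with the same
`i` are independent. By convexity of the exponential the Laplace transform of the normalised sum is
at most the largest of those of the inner sums. -/
lemma measure_weighted_sum_le {Ω : Type*} [MeasurableSpace Ω] {μ : Measure Ω}
    [IsProbabilityMeasure μ] {n d : ℕ} {q : Fin n → ℝ} (hq : ∀ i, 0 ≤ q i) (hq0 : 0 < ∑ i, q i)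
    {Z : Fin n → Fin d → Ω → ℝ} (hZm : ∀ i r, Measurable (Z i r)) (hZ0 : ∀ i r w, 0 ≤ Z i r w)
    {l ρ s : ℝ} (hl : 0 ≤ l) (hind : ∀ i, q i ≠ 0 → iIndepFun (Z i) μ)
    (hρ : ∀ i, q i ≠ 0 → ∀ r, mgf (Z i r) μ (-l) ≤ ρ) :
    μ.real {w | ∑ i, q i * ∑ r, Z i r w ≤ s * d * ∑ i, q i} ≤ (Real.exp (l * s) * ρ) ^ d := by
  set Q := ∑ i, q i with hQ
  let p : Fin n → ℝ := fun i => q i / Q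
  have hp : ∀ i, 0 ≤ p i := fun i => div_nonneg (hq i) hq0.le
  have hp1 : ∑ i, p i = 1 := by rw [← Finset.sum_div, ← hQ, div_self hq0.ne']
  let F : Fin n → Ω → ℝ := fun i => ∑ r, Z i r
  have hFm : ∀ i, Measurable (F i) := fun i => by
    have : F i = fun w => ∑ r, Z i r w := by ext w; simp [F]
    rw [this]
    exact Finset.measurable_fun_sum _ fun r _ => hZm i r
  have hF0 : ∀ i w, 0 ≤ F i w := fun i w => by
    simp only [F, Finset.sum_apply]
    exact Finset.sum_nonneg fun r _ => hZ0 i r w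
  let G : Ω → ℝ := fun w => ∑ i, p i * F i w
  have hGm : Measurable G := Finset.measurable_fun_sum _ fun i _ => (hFm i).const_mul _
  have hG0 : ∀ w, 0 ≤ G w := fun w => Finset.sum_nonneg fun i _ => mul_nonneg (hp i) (hF0 i w)
  have hint : ∀ H : Ω → ℝ, Measurable H → (∀ w, 0 ≤ H w) →
      Integrable (fun w => Real.exp (-l * H w)) μ := fun H hH hH0 => by
    refine Integrable.mono' (integrable_const (1 : ℝ)) (by fun_prop) (ae_of_all _ fun w => ?_)
    rw [Real.norm_eq_abs, Real.abs_exp, Real.exp_le_one_iff]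
    nlinarith [hH0 w]
  have hset : {w | ∑ i, q i * ∑ r, Z i r w ≤ s * d * Q} = {w | G w ≤ s * d} := by
    ext w
    have : ∑ i, q i * ∑ r, Z i r w = Q * G w := by
      rw [Finset.mul_sum]
      refine Finset.sum_congr rfl fun i _ => ?_
      simp only [p, F, Finset.sum_apply]
      field_simp
    simp only [Set.mem_ofPred_eq]
    rw [this, mul_comm (s * d) Q]
    exact mul_le_mul_iff_right₀ hq0
  have hmgf : mgf G μ (-l) ≤ ρ ^ d := by
    calc mgf G μ (-l) ≤ ∫ w, ∑ i, p i * Real.exp (-l * F i w) ∂μ := by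
          refine integral_mono (hint G hGm hG0)
            (integrable_finsetSum _ fun i _ => (hint _ (hFm i) (hF0 i)).const_mul _) fun w => ?_
          have h := convexOn_exp.map_sum_le (t := Finset.univ) (w := p)
            (p := fun i => -l * F i w) (fun i _ => hp i) hp1 (fun _ _ => Set.mem_univ _)
          simp only [smul_eq_mul] at h
          refine le_trans (le_of_eq ?_) h
          simp only [G, Finset.mul_sum]
          congr 1
          exact Finset.sum_congr rfl fun i _ => by ring
      _ = ∑ i, p i * mgf (F i) μ (-l) := by
          rw [integral_finsetSum _ fun i _ => (hint _ (hFm i) (hF0 i)).const_mul _]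
          exact Finset.sum_congr rfl fun i _ => integral_const_mul _ _
      _ ≤ ∑ i, p i * ρ ^ d := by
          refine Finset.sum_le_sum fun i _ => ?_
          by_cases hi : q i = 0
          · simp [p, hi]
          refine mul_le_mul_of_nonneg_left ?_ (hp i)
          rw [(hind i hi).mgf_sum (hZm i)]
          refine (Finset.prod_le_prod (fun r _ => mgf_nonneg) fun r _ => hρ i hi r).trans ?_
          simp
      _ = ρ ^ d := by rw [← Finset.sum_mul, hp1, one_mul]
  rw [hset]
  refine (measure_le_le_exp_mul_mgf (s * d) (neg_nonpos.2 hl) (hint G hGm hG0)).trans ?_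
  rw [mul_pow, ← Real.exp_nat_mul]
  refine mul_le_mul (le_of_eq ?_) hmgf mgf_nonneg (Real.exp_nonneg _)
  ring_nf

/-- The law of a finite family of independent standard Gaussian variables. -/
noncomputable abbrev stdGaussianPi (ι : Type*) [Fintype ι] : Measure (ι → ℝ) :=
  Measure.pi fun _ => gaussianReal 0 1

section StdGaussianPi

variable {ι : Type*} [Fintype ι]

lemma iIndepFun_eval_stdGaussianPi :
    iIndepFun (fun (e : ι) (w : ι → ℝ) => w e) (stdGaussianPi ι) :=
  iIndepFun_pi (X := fun _ x => x) fun _ => aemeasurable_id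

lemma hasLaw_eval_stdGaussianPi (e : ι) :
    HasLaw (fun w : ι → ℝ => w e) (gaussianReal 0 1) (stdGaussianPi ι) :=
  ⟨(measurable_pi_apply e).aemeasurable, (measurePreserving_eval _ e).map_eq⟩

lemma memLp_eval_stdGaussianPi (e : ι) :
    MemLp (fun w : ι → ℝ => w e) 2 (stdGaussianPi ι) := by
  have h : MemLp id 2 (gaussianReal 0 1) := memLp_id_gaussianReal 2
  exact h.comp_measurePreserving (measurePreserving_eval _ e)

lemma covariance_sum_stdGaussianPi (a b : ι → ℝ) :
    cov[fun w => ∑ e, a e * w e, fun w => ∑ e, b e * w e; stdGaussianPi ι] = ∑ e, a e * b e := by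
  classical
  rw [covariance_fun_sum_fun_sum (fun e => (memLp_eval_stdGaussianPi e).const_mul _)
    (fun e => (memLp_eval_stdGaussianPi e).const_mul _)]
  refine Finset.sum_congr rfl fun e _ => ?_
  rw [Finset.sum_eq_single e]
  · rw [covariance_const_mul_left, covariance_const_mul_right,
      covariance_self (measurable_pi_apply e).aemeasurable,
      (hasLaw_eval_stdGaussianPi e).variance_eq]
    simp
  · intro e' _ he
    rw [covariance_const_mul_left, covariance_const_mul_right,
      (iIndepFun_eval_stdGaussianPi.indepFun he.symm).covariance_eq_zero
        (memLp_eval_stdGaussianPi e) (memLp_eval_stdGaussianPi e')]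
    simp
  · simp

lemma integral_sum_stdGaussianPi (a : ι → ℝ) :
    ∫ w, ∑ e, a e * w e ∂(stdGaussianPi ι) = 0 := by
  rw [integral_finsetSum _ fun e _ =>
    ((memLp_eval_stdGaussianPi e).integrable (by norm_num)).const_mul _]
  refine Finset.sum_eq_zero fun e _ => ?_
  rw [integral_const_mul, (hasLaw_eval_stdGaussianPi e).integral_eq]
  simp

/-- Orthonormal linear forms of independent standard Gaussian variables are again independent
standard Gaussian variables: they are jointly Gaussian and uncorrelated. -/
lemma hasLaw_orthonormal_stdGaussianPi {κ : Type*} [Fintype κ] [DecidableEq κ] {a : κ → ι → ℝ}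
    (ha : ∀ i j, ∑ e, a i e * a j e = if i = j then 1 else 0) :
    HasLaw (fun (w : ι → ℝ) i => ∑ e, a i e * w e) (stdGaussianPi κ) (stdGaussianPi ι) := by
  have hid : HasGaussianLaw (fun (w : ι → ℝ) (e : ι) => w e) (stdGaussianPi ι) :=
    iIndepFun.hasGaussianLaw (X := fun (e : ι) (w : ι → ℝ) => w e) (fun e =>
      ⟨by rw [(hasLaw_eval_stdGaussianPi e).map_eq]; infer_instance⟩) iIndepFun_eval_stdGaussianPi
  let L : (ι → ℝ) →L[ℝ] (κ → ℝ) :=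
    ContinuousLinearMap.pi fun i => ∑ e, a i e • ContinuousLinearMap.proj e
  have hL : ∀ w, L w = fun i => ∑ e, a i e * w e := fun w => by
    ext i
    simp [L]
  have hG : HasGaussianLaw (fun (w : ι → ℝ) i => ∑ e, a i e * w e) (stdGaussianPi ι) := by
    have := hid.map_fun L
    simpa only [hL] using this
  refine (iIndepFun_iff_hasLaw_pi_pi (X := fun i (w : ι → ℝ) => ∑ e, a i e * w e) fun i => ?_).1
    (hG.iIndepFun_of_covariance_eq_zero fun i j hij => ?_)
  · refine ⟨(hG.eval i).aemeasurable, ?_⟩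
    rw [(hG.eval i).map_eq_gaussianReal, integral_sum_stdGaussianPi,
      ← covariance_self (hG.eval i).aemeasurable, covariance_sum_stdGaussianPi, ha]
    simp
  · rw [covariance_sum_stdGaussianPi, ha, if_neg hij]

end StdGaussianPi

/-! ### The Gaussian embedding of orthonormal patches -/

section Measurability

variable {Ω : Type*} [MeasurableSpace Ω] {p q : ℕ} {M : Ω → Matrix (Fin p) (Fin q) ℝ}

lemma measurable_specNorm (hM : ∀ i j, Measurable fun w => M w i j) :
    Measurable fun w => specNorm (M w) := by
  let L : (Fin p → Fin q → ℝ) →ₗ[ℝ] EuclideanSpace ℝ (Fin q) →L[ℝ] EuclideanSpace ℝ (Fin p) :=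
    LinearMap.toContinuousLinearMap.toLinearMap ∘ₗ Matrix.toEuclideanLin.toLinearMap ∘ₗ
      (Matrix.ofLinearEquiv ℝ).toLinearMap
  have hL : Continuous L := L.continuous_of_finiteDimensional
  exact hL.norm.measurable.comp
    (measurable_pi_lambda _ fun i => measurable_pi_lambda _ fun j => hM i j)

lemma measurable_frobNorm_sq (hM : ∀ i j, Measurable fun w => M w i j) :
    Measurable fun w => frobNorm (M w) ^ 2 := by
  simp_rw [frobNorm_sq]
  exact Finset.measurable_fun_sum _ fun i _ =>
    Finset.measurable_fun_sum _ fun j _ => (hM i j).pow_const 2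

end Measurability

lemma ProbabilityTheory.HasLaw.iIndepFun_of_pi {Ω κ : Type*} [MeasurableSpace Ω] {P : Measure Ω}
    [IsProbabilityMeasure P] [Fintype κ] {Y : Ω → κ → ℝ} (hY : HasLaw Y (stdGaussianPi κ) P) :
    (∀ i, HasLaw (fun w => Y w i) (gaussianReal 0 1) P) ∧ iIndepFun (fun i w => Y w i) P := by
  have h : ∀ i, HasLaw (fun w => Y w i) (gaussianReal 0 1) P := fun i =>
    (hasLaw_eval_stdGaussianPi i).comp hY
  exact ⟨h, (iIndepFun_iff_hasLaw_pi_pi h).2 hY⟩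

/-- The matrix with the given family of entries. -/
def entriesMatrix {p q : ℕ} (w : Fin p × Fin q → ℝ) : Matrix (Fin p) (Fin q) ℝ :=
  Matrix.of fun r s => w (r, s)

/-- The rectified linear unit, centred by the mean `1 / √(2π)` of a rectified standard Gaussian. -/
noncomputable def centredRelu (x : ℝ) : ℝ := relu x - 1 / √(2 * Real.pi)

lemma measurable_centredRelu : Measurable centredRelu := measurable_relu.sub_const _

lemma sum_sq_mul_coord {p q : ℕ} (y : EuclideanSpace ℝ (Fin p)) (z : EuclideanSpace ℝ (Fin q)) :
    ∑ e : Fin p × Fin q, (y e.1 * z e.2) ^ 2 = ‖y‖ ^ 2 * ‖z‖ ^ 2 := by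
  rw [EuclideanSpace.real_norm_sq_eq, EuclideanSpace.real_norm_sq_eq, Finset.sum_mul_sum,
    Fintype.sum_prod_type]
  simp [mul_pow]

lemma five_pow_mul_exp_le {a b : ℕ} {x : ℝ} (h : 2 * (a : ℝ) + x ≤ -3 * b) :
    5 ^ a * Real.exp x ≤ Real.exp (-3 * b) := by
  have h5 : (5 : ℝ) ≤ Real.exp 2 := by
    have h1 := Real.exp_one_gt_d9
    have h2 : Real.exp 2 = Real.exp 1 ^ 2 := by rw [← Real.exp_nat_mul]; norm_num
    rw [h2]
    nlinarith
  calc 5 ^ a * Real.exp x ≤ Real.exp 2 ^ a * Real.exp x := by gcongr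
    _ = Real.exp (2 * a + x) := by rw [← Real.exp_nat_mul, ← Real.exp_add]; ring_nf
    _ ≤ _ := Real.exp_le_exp.2 h

/-- The centred hidden layer has operator norm of order `√m`. -/
lemma measure_specNorm_centredRelu_le {m n : ℕ} (hnm : n ≤ m) :
    (stdGaussianPi (Fin m × Fin n)).real
      {g | 24 * √m < specNorm ((entriesMatrix g).map centredRelu)} ≤ Real.exp (-3 * m) := by
  have hM : ∀ (y : EuclideanSpace ℝ (Fin m)) (z : EuclideanSpace ℝ (Fin n)), ‖y‖ ≤ 1 → ‖z‖ ≤ 1 →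
      HasSubgaussianMGF (fun g => inner ℝ y (Matrix.toEuclideanLin
        ((entriesMatrix g).map centredRelu) z)) (1 * 2) (stdGaussianPi (Fin m × Fin n)) := by
    intro y z hy hz
    simp_rw [inner_toEuclideanLin]
    refine hasSubgaussianMGF_sum_mul (X := fun e (g : Fin m × Fin n → ℝ) => centredRelu (g e))
      (iIndepFun_eval_stdGaussianPi.comp (fun _ => centredRelu) fun _ => measurable_centredRelu)
      (fun e => ?_) ?_
    · refine HasSubgaussianMGF.of_map (X := centredRelu) (Y := fun g : Fin m × Fin n → ℝ => g e)
        (measurable_pi_apply e).aemeasurable ?_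
      rw [(hasLaw_eval_stdGaussianPi e).map_eq]
      exact hasSubgaussianMGF_relu_sub
    · rw [sum_sq_mul_coord]
      have h1 := pow_le_one₀ (n := 2) (norm_nonneg y) hy
      have h2 := pow_le_one₀ (n := 2) (norm_nonneg z) hz
      simpa using mul_le_one₀ h1 (sq_nonneg _) h2
  -- The exponent is `-(6 √m)² / 4 = -9 m`, which beats the `5 ^ (m + n) ≤ exp (4 m)` net points.
  have h := measure_specNorm_gt_le hM (t := 6 * √m) (by positivity)
  have e1 : 4 * (6 * √(m : ℝ)) = 24 * √m := by ring
  rw [e1] at h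
  refine h.trans (five_pow_mul_exp_le ?_)
  rw [mul_pow, Real.sq_sqrt (Nat.cast_nonneg m)]
  push_cast
  have : (n : ℝ) ≤ m := by exact_mod_cast hnm
  linarith

/-- If `f` is a function of a Gaussian with a small-ball estimate at scale `1 / 200`, the Laplace
transform of `f²` at `240000 = 6 · 200²` is at most `1 / 100`. -/
lemma mgf_neg_sq_le_one_div_hundred {Ω : Type*} [MeasurableSpace Ω] {P : Measure Ω} {g : Ω → ℝ}
    (hg : HasLaw g (gaussianReal 0 1) P) {f : ℝ → ℝ} (hf : Measurable f) {a : ℝ}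
    (hfa : ∀ x, |f x| ≤ 1 / 200 → x ∈ Set.Icc (a - 1 / 200) (a + 1 / 200)) :
    mgf (fun w => f (g w) ^ 2) P (-240000) ≤ 1 / 100 := by
  have h1 : mgf (fun w => f (g w) ^ 2) P (-240000)
      = mgf (fun x => f x ^ 2) (gaussianReal 0 1) (-240000) := by
    rw [mgf, mgf, ← hg.integral_comp (f := fun x => Real.exp (-240000 * f x ^ 2)) (by fun_prop)]
    rfl
  rw [h1]
  refine (mgf_neg_sq_le (by norm_num) (by norm_num) hfa).trans ?_
  have h2 : Real.exp (-240000 * (1 / 200) ^ 2) ≤ 1 / 200 := by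
    have h3 : (200 : ℝ) ≤ Real.exp 6 := by
      have h4 : Real.exp 6 = Real.exp 1 ^ 6 := by rw [← Real.exp_nat_mul]; norm_num
      rw [h4]
      calc (200 : ℝ) ≤ (2.7 : ℝ) ^ 6 := by norm_num
        _ ≤ _ := by
          gcongr
          linarith [Real.exp_one_gt_d9]
    have h5 : (-240000 * (1 / 200) ^ 2 : ℝ) = -6 := by norm_num
    rw [h5, Real.exp_neg, one_div]
    gcongr
  linarith

lemma exp_mul_one_div_hundred_pow_le (d : ℕ) :
    (Real.exp (240000 * (1 / 240000)) * (1 / 100)) ^ d ≤ Real.exp (-3 * d) := by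
  have h1 : Real.exp 1 * (1 / 100) ≤ Real.exp (-3) := by
    have h2 : Real.exp 4 ≤ 100 := by
      have h4 : Real.exp 4 = Real.exp 1 ^ 4 := by rw [← Real.exp_nat_mul]; norm_num
      rw [h4]
      calc Real.exp 1 ^ 4 ≤ (3 : ℝ) ^ 4 := by
            gcongr
            linarith [Real.exp_one_lt_d9]
        _ ≤ 100 := by norm_num
    have h5 : Real.exp 1 = Real.exp (-3) * Real.exp 4 := by rw [← Real.exp_add]; norm_num
    rw [h5]
    nlinarith [Real.exp_pos (-3)]
  have h6 : (240000 * (1 / 240000) : ℝ) = 1 := by norm_num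
  rw [h6, mul_comm (-3 : ℝ), Real.exp_nat_mul]
  gcongr

/-- The small-ball property of the centred rectifier: on its flat part `x ≤ 0` it equals
`-1 / √(2π)`, which is far from `0`. -/
lemma mem_Icc_of_abs_centredRelu_le {x : ℝ} (h : |centredRelu x| ≤ 1 / 200) :
    x ∈ Set.Icc (1 / √(2 * Real.pi) - 1 / 200) (1 / √(2 * Real.pi) + 1 / 200) := by
  have h1 : (1 : ℝ) / 100 < 1 / √(2 * Real.pi) := by
    refine one_div_lt_one_div_of_lt (by positivity) ?_
    rw [Real.sqrt_lt' (by norm_num)]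
    have := Real.pi_lt_four
    linarith
  rw [abs_le] at h
  simp only [centredRelu, relu] at h
  have hx : 0 < x := by
    by_contra hx
    rw [max_eq_right (not_lt.1 hx)] at h
    linarith
  rw [max_eq_left hx.le] at h
  exact ⟨by linarith, by linarith⟩

/-- The centred hidden layer has squared Frobenius norm of order `m n`. -/
lemma measure_frobNorm_centredRelu_le {m n : ℕ} (hn : 0 < n) :
    (stdGaussianPi (Fin m × Fin n)).real
      {g | frobNorm ((entriesMatrix g).map centredRelu) ^ 2 ≤ 1 / 240000 * m * n}
      ≤ Real.exp (-3 * m) := by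
  have h := measure_weighted_sum_le (μ := stdGaussianPi (Fin m × Fin n)) (q := fun _ : Fin n => 1)
    (Z := fun i s g => centredRelu (g (s, i)) ^ 2) (l := 240000) (ρ := 1 / 100) (s := 1 / 240000)
    (d := m) (fun _ => zero_le_one) (by simpa using hn)
    (fun i s => (measurable_centredRelu.comp (measurable_pi_apply (s, i))).pow_const 2)
    (fun _ _ _ => sq_nonneg _) (by norm_num)
    (fun i _ => (iIndepFun_eval_stdGaussianPi.precomp (g := fun s : Fin m => (s, i))
      (fun a b hab => (Prod.mk.inj hab).1)).comp (fun _ x => centredRelu x ^ 2)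
      fun _ => measurable_centredRelu.pow_const 2)
    (fun i _ s => mgf_neg_sq_le_one_div_hundred (hasLaw_eval_stdGaussianPi (s, i))
      measurable_centredRelu fun x => mem_Icc_of_abs_centredRelu_le)
  refine le_trans (le_of_eq ?_) (h.trans (exp_mul_one_div_hundred_pow_le m))
  congr 1
  ext g
  simp only [frobNorm_sq, Set.mem_ofPred_eq, one_mul, Finset.sum_const, Finset.card_univ,
    Fintype.card_fin, nsmul_eq_mul, mul_one, Matrix.map_apply, entriesMatrix, Matrix.of_apply]
  rw [Finset.sum_comm]

/-- Multiplying a fixed matrix by a Gaussian matrix with `d` rows multiplies its squared Frobenius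
norm by at least a constant multiple of `d`. -/
lemma measure_frobNorm_gaussian_mul_le {d m n : ℕ} {X : Matrix (Fin m) (Fin n) ℝ}
    (hX : 0 < frobNorm X ^ 2) :
    (stdGaussianPi (Fin d × Fin m)).real
      {w | frobNorm (entriesMatrix w * X) ^ 2 ≤ 1 / 240000 * d * frobNorm X ^ 2}
      ≤ Real.exp (-3 * d) := by
  let q : Fin n → ℝ := fun i => ∑ s, X s i ^ 2
  have hq : ∀ i, 0 ≤ q i := fun i => Finset.sum_nonneg fun s _ => sq_nonneg _
  have hqX : ∑ i, q i = frobNorm X ^ 2 := by rw [frobNorm_sq, Finset.sum_comm]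
  -- Column `i` of the product is `√(q i)` times a vector of `d` independent standard Gaussians; for
  -- `q i = 0` the division in `a` gives `0`, and the column vanishes.
  let a : Fin n → Fin d → Fin d × Fin m → ℝ := fun i r e => if r = e.1 then X e.2 i / √(q i) else 0
  have hsum : ∀ (i : Fin n) (r : Fin d) (f : Fin d × Fin m → ℝ),
      ∑ e, a i r e * f e = ∑ s, X s i / √(q i) * f (r, s) := fun i r f => by
    rw [Fintype.sum_prod_type, Finset.sum_eq_single r]
    · simp [a]
    · intro r' _ hr
      simp [a, hr.symm]
    · simp
  have hlaw : ∀ i, q i ≠ 0 → HasLaw (fun (w : Fin d × Fin m → ℝ) r => ∑ e, a i r e * w e)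
      (stdGaussianPi (Fin d)) (stdGaussianPi (Fin d × Fin m)) := fun i hi => by
    refine hasLaw_orthonormal_stdGaussianPi fun r r' => ?_
    rw [hsum]
    by_cases hr : r = r'
    · subst hr
      simp only [a, if_true]
      simp_rw [div_mul_div_comm, Real.mul_self_sqrt (hq i), ← sq]
      rw [← Finset.sum_div, div_self hi]
    · have hr' : r' ≠ r := fun h => hr h.symm
      simp [a, hr, hr']
  have h := measure_weighted_sum_le (μ := stdGaussianPi (Fin d × Fin m)) (q := q)
    (Z := fun i r w => (∑ e, a i r e * w e) ^ 2) (l := 240000) (ρ := 1 / 100) (s := 1 / 240000)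
    (d := d) hq (by rwa [hqX]) (fun i r => by fun_prop)
    (fun _ _ _ => sq_nonneg _) (by norm_num)
    (fun i hi => (hlaw i hi).iIndepFun_of_pi.2.comp (fun _ x => x ^ 2) fun _ => by fun_prop)
    (fun i hi r => mgf_neg_sq_le_one_div_hundred (f := fun x => x) (a := 0)
      ((hlaw i hi).iIndepFun_of_pi.1 r) measurable_id fun x hx => by
        rw [abs_le] at hx
        exact ⟨by linarith, by linarith⟩)
  refine le_trans (le_of_eq ?_) (h.trans (exp_mul_one_div_hundred_pow_le d))
  congr 1
  ext w
  have key : frobNorm (entriesMatrix w * X) ^ 2 = ∑ i, q i * ∑ r, (∑ e, a i r e * w e) ^ 2 := by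
    rw [frobNorm_sq, Finset.sum_comm]
    refine Finset.sum_congr rfl fun i _ => ?_
    rw [Finset.mul_sum]
    refine Finset.sum_congr rfl fun r _ => ?_
    rw [hsum]
    by_cases hi : q i = 0
    · have hz : ∀ s, X s i = 0 := fun s => by
        have := (Finset.sum_eq_zero_iff_of_nonneg fun s _ => sq_nonneg (X s i)).1 hi s
          (Finset.mem_univ s)
        simpa using this
      simp [Matrix.mul_apply, hz, hi]
    · have hs : √(q i) ≠ 0 := (Real.sqrt_pos.2 ((hq i).lt_of_ne' hi)).ne'
      rw [Matrix.mul_apply]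
      simp_rw [div_mul_eq_mul_div]
      rw [← Finset.sum_div, div_pow, Real.sq_sqrt (hq i), mul_div_cancel₀ _ hi]
      congr 1
      exact Finset.sum_congr rfl fun s _ => by simp [entriesMatrix, mul_comm]
  simp only [Set.mem_ofPred_eq, key, hqX]

/-- A Gaussian matrix with `d` rows maps a fixed matrix of operator norm of order `√m` with `n`
columns to one of operator norm of order `√m √(d + n)`. -/
lemma measure_specNorm_gaussian_mul_le {d m n : ℕ} (hm : 0 < m) {X : Matrix (Fin m) (Fin n) ℝ}
    (hX : specNorm X ≤ 24 * √m) :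
    (stdGaussianPi (Fin d × Fin m)).real
      {w | 304 * (√m * √(d + n)) < specNorm (entriesMatrix w * X)} ≤ Real.exp (-3 * d) := by
  have hM : ∀ (y : EuclideanSpace ℝ (Fin d)) (z : EuclideanSpace ℝ (Fin n)), ‖y‖ ≤ 1 → ‖z‖ ≤ 1 →
      HasSubgaussianMGF (fun w => inner ℝ y (Matrix.toEuclideanLin (entriesMatrix w * X) z))
        ((576 * m : ℝ≥0) * 1) (stdGaussianPi (Fin d × Fin m)) := by
    intro y z hy hz
    have e1 : ∀ w : Fin d × Fin m → ℝ, Matrix.toEuclideanLin (entriesMatrix w * X) z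
        = Matrix.toEuclideanLin (entriesMatrix w) (Matrix.toEuclideanLin X z) := fun w => by
      simp [Matrix.toLpLin_apply, Matrix.mulVec_mulVec]
    simp_rw [e1, inner_toEuclideanLin]
    refine hasSubgaussianMGF_sum_mul (X := fun e (w : Fin d × Fin m → ℝ) => w e)
      iIndepFun_eval_stdGaussianPi (fun e => ?_) ?_
    · refine HasSubgaussianMGF.of_map (X := id) (Y := fun g : Fin d × Fin m → ℝ => g e)
        (measurable_pi_apply e).aemeasurable ?_
      rw [(hasLaw_eval_stdGaussianPi e).map_eq]
      exact hasSubgaussianMGF_id_gaussianReal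
    · rw [sum_sq_mul_coord]
      have h1 := pow_le_one₀ (n := 2) (norm_nonneg y) hy
      have h2 : ‖Matrix.toEuclideanLin X z‖ ≤ 24 * √m := by
        have := norm_toEuclideanLin_le X z
        nlinarith [specNorm_nonneg X, norm_nonneg z]
      have h3 := pow_le_pow_left₀ (norm_nonneg _) h2 2
      rw [mul_pow, Real.sq_sqrt (Nat.cast_nonneg m)] at h3
      push_cast
      nlinarith [sq_nonneg ‖y‖, sq_nonneg ‖Matrix.toEuclideanLin X z‖]
  -- As `76² / (2 · 576) > 5`, the exponent beats the `5 ^ (d + n) ≤ exp (2 (d + n))` net points.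
  have h := measure_specNorm_gt_le hM (t := 76 * (√m * √(d + n))) (by positivity)
  have e1 : 4 * (76 * (√(m : ℝ) * √(d + n))) = 304 * (√m * √(d + n)) := by ring
  rw [e1] at h
  refine h.trans (five_pow_mul_exp_le ?_)
  have hm' : (0 : ℝ) < m := by exact_mod_cast hm
  rw [mul_pow, mul_pow, Real.sq_sqrt hm'.le, Real.sq_sqrt (by positivity)]
  push_cast
  have e2 : -((76 : ℝ) ^ 2 * (m * (d + n))) / (2 * (576 * m * 1)) = -(5776 / 1152 * (d + n)) := by
    field_simp
    ring
  rw [e2]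
  have : (0 : ℝ) ≤ n := Nat.cast_nonneg n
  have : (0 : ℝ) ≤ d := Nat.cast_nonneg d
  linarith

lemma measureReal_prod_le {Ω Ω' : Type*} [MeasurableSpace Ω] [MeasurableSpace Ω'] {μ : Measure Ω}
    {ν : Measure Ω'} [IsProbabilityMeasure μ] [IsProbabilityMeasure ν] {S : Set (Ω × Ω')}
    (hS : MeasurableSet S) {c : ℝ} (hc : 0 ≤ c) (h : ∀ x, ν.real (Prod.mk x ⁻¹' S) ≤ c) :
    (μ.prod ν).real S ≤ c := by
  rw [Measure.real, Measure.prod_apply hS]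
  refine ENNReal.toReal_le_of_le_ofReal hc ?_
  calc ∫⁻ x, ν (Prod.mk x ⁻¹' S) ∂μ ≤ ∫⁻ _, ENNReal.ofReal c ∂μ := by
        refine lintegral_mono fun x => ?_
        rw [← ENNReal.ofReal_toReal (measure_ne_top ν _)]
        exact ENNReal.ofReal_le_ofReal (h x)
    _ = ENNReal.ofReal c := by simp

/-- The event, in terms of the Gaussian pre-activations `x.1` and the second layer `x.2`, on which
the product of the second layer and the centred hidden layer has operator norm at most of order
`√m √(d + n)` and squared Frobenius norm at least of order `d m n`. -/
def wellSpread (m n d : ℕ) : Set ((Fin m × Fin n → ℝ) × (Fin d × Fin m → ℝ)) :=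
  {x | specNorm (entriesMatrix x.2 * (entriesMatrix x.1).map centredRelu)
      ≤ 304 * (√m * √(d + n)) ∧
    1 / 240000 * d * (1 / 240000 * m * n)
      ≤ frobNorm (entriesMatrix x.2 * (entriesMatrix x.1).map centredRelu) ^ 2}

lemma measurable_mul_map_centredRelu (m n d : ℕ) (r : Fin d) (i : Fin n) :
    Measurable fun x : (Fin m × Fin n → ℝ) × (Fin d × Fin m → ℝ) =>
      (entriesMatrix x.2 * (entriesMatrix x.1).map centredRelu) r i := by
  simp only [Matrix.mul_apply, entriesMatrix, Matrix.of_apply, Matrix.map_apply]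
  have := measurable_centredRelu
  fun_prop

lemma measurableSet_wellSpread (m n d : ℕ) : MeasurableSet (wellSpread m n d) := by
  have h := measurable_mul_map_centredRelu m n d
  exact (measurableSet_le (measurable_specNorm h) measurable_const).inter
    (measurableSet_le measurable_const (measurable_frobNorm_sq h))

lemma measure_compl_wellSpread_le {m n d : ℕ} (hn : 0 < n) (hnm : n < m) :
    ((stdGaussianPi (Fin m × Fin n)).prod (stdGaussianPi (Fin d × Fin m))).real
      (wellSpread m n d)ᶜ ≤ 2 * Real.exp (-3 * m) + 2 * Real.exp (-3 * d) := by
  set μ := stdGaussianPi (Fin m × Fin n)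
  set ν := stdGaussianPi (Fin d × Fin m)
  let A := {g : Fin m × Fin n → ℝ | 24 * √m < specNorm ((entriesMatrix g).map centredRelu)}
  let B := {g : Fin m × Fin n → ℝ |
    frobNorm ((entriesMatrix g).map centredRelu) ^ 2 ≤ 1 / 240000 * m * n}
  let C := {x : (Fin m × Fin n → ℝ) × (Fin d × Fin m → ℝ) |
    0 < frobNorm ((entriesMatrix x.1).map centredRelu) ^ 2 ∧
    frobNorm (entriesMatrix x.2 * (entriesMatrix x.1).map centredRelu) ^ 2
      ≤ 1 / 240000 * d * frobNorm ((entriesMatrix x.1).map centredRelu) ^ 2}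
  let D := {x : (Fin m × Fin n → ℝ) × (Fin d × Fin m → ℝ) |
    specNorm ((entriesMatrix x.1).map centredRelu) ≤ 24 * √m ∧
    304 * (√m * √(d + n)) < specNorm (entriesMatrix x.2 * (entriesMatrix x.1).map centredRelu)}
  have hP := measurable_mul_map_centredRelu m n d
  have hX : ∀ s i, Measurable fun x : (Fin m × Fin n → ℝ) × (Fin d × Fin m → ℝ) =>
      (entriesMatrix x.1).map centredRelu s i := fun s i =>
    measurable_centredRelu.comp ((measurable_pi_apply (s, i)).comp measurable_fst)
  have hF := measurable_frobNorm_sq hX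
  have hC : MeasurableSet C := (measurableSet_lt measurable_const hF).inter
    (measurableSet_le (measurable_frobNorm_sq hP) (hF.const_mul _))
  have hD : MeasurableSet D :=
    (measurableSet_le (measurable_specNorm hX) measurable_const).inter
      (measurableSet_lt measurable_const (measurable_specNorm hP))
  have hsub : (wellSpread m n d)ᶜ ⊆ ((A ×ˢ Set.univ) ∪ (B ×ˢ Set.univ)) ∪ (C ∪ D) := by
    rintro ⟨g, w⟩ hx
    by_contra hcon
    simp only [Set.mem_union, not_or, Set.mem_prod, Set.mem_univ, and_true] at hcon
    obtain ⟨⟨hA', hB'⟩, hC', hD'⟩ := hcon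
    simp only [A, B, C, D, Set.mem_ofPred_eq, not_lt, not_le, not_and] at hA' hB' hC' hD'
    refine hx ⟨hD' hA', ?_⟩
    have h0 : (0 : ℝ) ≤ 1 / 240000 * m * n := by positivity
    refine le_trans ?_ (hC' (h0.trans_lt hB')).le
    exact mul_le_mul_of_nonneg_left hB'.le (by positivity)
  have e1 : (μ.prod ν).real (A ×ˢ Set.univ) ≤ Real.exp (-3 * m) := by
    rw [measureReal_prod_prod, probReal_univ, mul_one]
    exact measure_specNorm_centredRelu_le hnm.le
  have e2 : (μ.prod ν).real (B ×ˢ Set.univ) ≤ Real.exp (-3 * m) := by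
    rw [measureReal_prod_prod, probReal_univ, mul_one]
    exact measure_frobNorm_centredRelu_le hn
  have e3 : (μ.prod ν).real C ≤ Real.exp (-3 * d) := by
    refine measureReal_prod_le hC (Real.exp_nonneg _) fun g => ?_
    by_cases hg : 0 < frobNorm ((entriesMatrix g).map centredRelu) ^ 2
    · refine le_trans (measureReal_mono fun w hw => ?_) (measure_frobNorm_gaussian_mul_le hg)
      exact hw.2
    · have : Prod.mk g ⁻¹' C = ∅ := by
        ext w
        simp only [C, Set.mem_preimage, Set.mem_ofPred_eq, Set.mem_empty_iff_false, iff_false]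
        exact fun h => hg h.1
      rw [this, measureReal_empty]
      exact Real.exp_nonneg _
  have e4 : (μ.prod ν).real D ≤ Real.exp (-3 * d) := by
    refine measureReal_prod_le hD (Real.exp_nonneg _) fun g => ?_
    by_cases hg : specNorm ((entriesMatrix g).map centredRelu) ≤ 24 * √m
    · refine le_trans (measureReal_mono fun w hw => ?_)
        (measure_specNorm_gaussian_mul_le (hn.trans hnm) hg)
      exact hw.2
    · have : Prod.mk g ⁻¹' D = ∅ := by
        ext w
        simp only [D, Set.mem_preimage, Set.mem_ofPred_eq, Set.mem_empty_iff_false, iff_false]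
        exact fun h => hg h.1
      rw [this, measureReal_empty]
      exact Real.exp_nonneg _
  have u1 := measureReal_union_le (μ := μ.prod ν) (A ×ˢ Set.univ) (B ×ˢ Set.univ)
  have u2 := measureReal_union_le (μ := μ.prod ν) C D
  have u3 := measureReal_union_le (μ := μ.prod ν) ((A ×ˢ Set.univ) ∪ (B ×ˢ Set.univ)) (C ∪ D)
  have u4 := measureReal_mono (μ := μ.prod ν) hsub
  linarith

/-! ### Normalisation of the random embedding -/

lemma hasLaw_gaussianReal_div_sqrt {Ω : Type*} [MeasurableSpace Ω] {P : Measure Ω} {X : Ω → ℝ}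
    {α : ℝ≥0} (hα : 0 < α) (hX : HasLaw X (gaussianReal 0 α) P) :
    HasLaw (fun w => X w / √(α : ℝ)) (gaussianReal 0 1) P := by
  refine HasLaw.comp (Y := fun x : ℝ => x / √(α : ℝ)) ⟨by fun_prop, ?_⟩ hX
  rw [gaussianReal_map_div_const]
  congr 1
  · simp
  · rw [← NNReal.coe_inj]
    have hα' : (α : ℝ) ≠ 0 := by exact_mod_cast hα.ne'
    change (α : ℝ) / √(α : ℝ) ^ 2 = 1
    rw [Real.sq_sqrt α.coe_nonneg]
    exact div_self hα'

/-- After normalisation, the Gaussian pre-activations of orthonormal patches and the entries of `W₂`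
are independent standard Gaussian variables. -/
lemma IsGaussianPair.hasLaw_prod {k m n d : ℕ} {Ω : Type*} [MeasurableSpace Ω] {P : Measure Ω}
    [IsProbabilityMeasure P] {α β : ℝ≥0} (hα : 0 < α) (hβ : 0 < β)
    {W₁ : Ω → Matrix (Fin m) (Fin k) ℝ} {W₂ : Ω → Matrix (Fin d) (Fin m) ℝ}
    (h : IsGaussianPair P α β W₁ W₂) {u : Fin n → EuclideanSpace ℝ (Fin k)}
    (hu : Orthonormal ℝ u) :
    HasLaw (fun w => (fun e : Fin m × Fin n => ∑ t, W₁ w e.1 t / √(α : ℝ) * u e.2 t,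
        fun e : Fin d × Fin m => W₂ w e.1 e.2 / √(β : ℝ)))
      ((stdGaussianPi (Fin m × Fin n)).prod (stdGaussianPi (Fin d × Fin m))) P := by
  let c : (Fin m × Fin k) ⊕ (Fin d × Fin m) → ℝ := Sum.elim (fun _ => √(α : ℝ)) fun _ => √(β : ℝ)
  have h0 : HasLaw (fun w e => Sum.elim (fun a => W₁ w a.1 a.2) (fun a => W₂ w a.1 a.2) e / c e)
      (stdGaussianPi ((Fin m × Fin k) ⊕ (Fin d × Fin m))) P := by
    refine (h.indep.comp (fun e x => x / c e) fun e => by fun_prop).hasLaw_pi fun e => ?_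
    rcases e with a | a
    · exact hasLaw_gaussianReal_div_sqrt hα (h.law₁ a.1 a.2)
    · exact hasLaw_gaussianReal_div_sqrt hβ (h.law₂ a.1 a.2)
  have hs : MeasurePreserving (MeasurableEquiv.sumPiEquivProdPi fun _ => ℝ)
      (stdGaussianPi ((Fin m × Fin k) ⊕ (Fin d × Fin m)))
      ((stdGaussianPi (Fin m × Fin k)).prod (stdGaussianPi (Fin d × Fin m))) :=
    measurePreserving_sumPiEquivProdPi fun _ => gaussianReal 0 1
  let a : Fin m × Fin n → Fin m × Fin k → ℝ := fun i e => if i.1 = e.1 then u i.2 e.2 else 0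
  have hsum : ∀ (i : Fin m × Fin n) (f : Fin m × Fin k → ℝ),
      ∑ e, a i e * f e = ∑ t, u i.2 t * f (i.1, t) := fun i f => by
    rw [Fintype.sum_prod_type, Finset.sum_eq_single i.1]
    · simp [a]
    · intro r' _ hr
      simp [a, hr.symm]
    · simp
  have ha : ∀ i j, ∑ e, a i e * a j e = if i = j then 1 else 0 := fun i j => by
    rw [hsum]
    have hin : ∑ t, u i.2 t * u j.2 t = if i.2 = j.2 then 1 else 0 := by
      have h1 := orthonormal_iff_ite.1 hu i.2 j.2
      rw [PiLp.inner_apply] at h1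
      rw [← h1]
      exact Finset.sum_congr rfl fun t _ => by simp [mul_comm]
    by_cases h1 : i.1 = j.1
    · have h2 : (i = j) = (i.2 = j.2) := by simp [Prod.ext_iff, h1]
      simp [a, h1, hin, h2]
    · have h1' : j.1 ≠ i.1 := fun h => h1 h.symm
      have h2 : i ≠ j := fun h => h1 (by rw [h])
      simp [a, h1', h2]
  have hlaw := hasLaw_orthonormal_stdGaussianPi ha
  have hL : MeasurePreserving (fun (w : Fin m × Fin k → ℝ) i => ∑ e, a i e * w e)
      (stdGaussianPi (Fin m × Fin k)) (stdGaussianPi (Fin m × Fin n)) :=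
    hlaw.measurePreserving (by fun_prop)
  have hpr := (hL.prod (MeasurePreserving.id (stdGaussianPi (Fin d × Fin m)))).comp hs
  refine (HasLaw.comp ⟨hpr.measurable.aemeasurable, hpr.map_eq⟩ h0).congr
    (ae_of_all _ fun w => ?_)
  refine Prod.ext (funext fun i => ?_) (funext fun e => ?_)
  · simp only [Function.comp_apply, Prod.map_fst]
    rw [hsum]
    exact Finset.sum_congr rfl fun t _ => mul_comm _ _
  · rfl

lemma relu_mul {a : ℝ} (ha : 0 ≤ a) (x : ℝ) : relu (a * x) = a * relu x := by
  simp [relu, mul_max_of_nonneg _ _ ha]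

/-- With the centring bias, the embedding is positively homogeneous in both weight matrices, and it
is the product of the normalised second layer with the centred hidden layer. -/
lemma embedMatrix_centeringBias {k m n d : ℕ} {α β : ℝ≥0} (hα : 0 < α) (hβ : 0 < β)
    (W₁ : Matrix (Fin m) (Fin k) ℝ) (W₂ : Matrix (Fin d) (Fin m) ℝ)
    (u : Fin n → EuclideanSpace ℝ (Fin k)) :
    embedMatrix W₁ W₂ (centeringBias α W₂) (patchMatrix u) = (√(α : ℝ) * √(β : ℝ)) •
      (entriesMatrix (fun e : Fin d × Fin m => W₂ e.1 e.2 / √(β : ℝ)) *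
        (entriesMatrix fun e : Fin m × Fin n => ∑ t, W₁ e.1 t / √(α : ℝ) * u e.2 t).map
          centredRelu) := by
  have hα' : √(α : ℝ) ≠ 0 := (Real.sqrt_pos.2 (by exact_mod_cast hα)).ne'
  have hβ' : √(β : ℝ) ≠ 0 := (Real.sqrt_pos.2 (by exact_mod_cast hβ)).ne'
  ext r i
  have h1 : ∀ s, relu (∑ t, W₁ s t * u i t)
      = √(α : ℝ) * relu (∑ t, W₁ s t / √(α : ℝ) * u i t) := fun s => by
    rw [← relu_mul (Real.sqrt_nonneg _), Finset.mul_sum]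
    congr 1
    exact Finset.sum_congr rfl fun t _ => by field_simp
  simp only [embedMatrix, embed, centeringBias, patchMatrix, Matrix.of_apply, Pi.add_apply,
    Pi.neg_apply, Pi.smul_apply, Matrix.mulVec, dotProduct, smul_eq_mul, Matrix.smul_apply,
    Matrix.mul_apply, Matrix.map_apply, entriesMatrix, centredRelu, h1, mul_one]
  rw [Finset.mul_sum, Finset.mul_sum, ← sub_eq_add_neg, ← Finset.sum_sub_distrib]
  refine Finset.sum_congr rfl fun s _ => ?_
  field_simp

/-- On `wellSpread`, the product `A` satisfies `κ min(d, n) ‖A‖₂² ≤ ‖A‖_F²` with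
`κ = 2 (240000⁻¹ / 608)²`, because `min(d, n) (d + n) ≤ 2 d n` (and `608 = 2 · 304`). -/
lemma mul_min_le_of_mem_wellSpread {m n d : ℕ} (hm : 0 < m) (hn : 0 < n) (hd : 0 < d)
    {x : (Fin m × Fin n → ℝ) × (Fin d × Fin m → ℝ)} (hx : x ∈ wellSpread m n d) :
    0 < specNorm (entriesMatrix x.2 * (entriesMatrix x.1).map centredRelu) ∧
    2 * (1 / 240000 / 608) ^ 2 * (min d n : ℕ) *
        specNorm (entriesMatrix x.2 * (entriesMatrix x.1).map centredRelu) ^ 2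
      ≤ frobNorm (entriesMatrix x.2 * (entriesMatrix x.1).map centredRelu) ^ 2 := by
  obtain ⟨h1, h2⟩ := hx
  set A := entriesMatrix x.2 * (entriesMatrix x.1).map centredRelu
  have hm' : (0 : ℝ) < m := by exact_mod_cast hm
  have hn' : (0 : ℝ) < n := by exact_mod_cast hn
  have hd' : (0 : ℝ) < d := by exact_mod_cast hd
  constructor
  · refine (specNorm_nonneg A).lt_of_ne fun h0 => ?_
    have h3 := frobNorm_sq_le_rank_mul A (finrank_range_toEuclideanLin_le_right A)
    rw [← h0] at h3
    have h4 : 0 < 1 / 240000 * (d : ℝ) * (1 / 240000 * m * n) := by positivity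
    linarith
  · have h3 := pow_le_pow_left₀ (specNorm_nonneg A) h1 2
    rw [mul_pow, mul_pow, Real.sq_sqrt hm'.le, Real.sq_sqrt (by positivity)] at h3
    have h4 : ((min d n : ℕ) : ℝ) * (d + n) ≤ 2 * (d * n) := by
      rcases le_total d n with h | h
      · have : (d : ℝ) ≤ n := by exact_mod_cast h
        rw [min_eq_left h]
        nlinarith
      · have : (n : ℝ) ≤ d := by exact_mod_cast h
        rw [min_eq_right h]
        nlinarith
    calc 2 * (1 / 240000 / 608) ^ 2 * ((min d n : ℕ) : ℝ) * specNorm A ^ 2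
        ≤ 2 * (1 / 240000 / 608) ^ 2 * ((min d n : ℕ) : ℝ) * (304 ^ 2 * (m * (d + n))) := by gcongr
      _ = 1 / 2 * (1 / 240000) ^ 2 * m * (((min d n : ℕ) : ℝ) * (d + n)) := by ring
      _ ≤ 1 / 2 * (1 / 240000) ^ 2 * m * (2 * (d * n)) := by gcongr
      _ = 1 / 240000 * d * (1 / 240000 * m * n) := by ring
      _ ≤ _ := h2

lemma exp_neg_three_mul_le {δ : ℝ} (hδ : 0 < δ) {m : ℕ} (hm : 0 < m)
    (h : Real.log (1 / δ) ≤ m) : Real.exp (-3 * m) ≤ δ / 4 := by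
  have h1 : Real.exp (-(m : ℝ)) ≤ δ := by
    rw [← Real.le_log_iff_exp_le hδ]
    rw [one_div, Real.log_inv] at h
    linarith
  have hm' : (1 : ℝ) ≤ m := by exact_mod_cast hm
  have h2 : Real.exp (-2) ≤ 1 / 4 := by
    have h3 : (4 : ℝ) ≤ Real.exp 2 := by
      have h4 : Real.exp 2 = Real.exp 1 ^ 2 := by rw [← Real.exp_nat_mul]; norm_num
      rw [h4]
      nlinarith [Real.exp_one_gt_d9]
    rw [Real.exp_neg, one_div]
    gcongr
  calc Real.exp (-3 * m) ≤ Real.exp (-(m : ℝ) + -2) := Real.exp_le_exp.2 (by linarith)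
    _ = Real.exp (-(m : ℝ)) * Real.exp (-2) := Real.exp_add _ _
    _ ≤ δ * (1 / 4) := by gcongr
    _ = δ / 4 := by ring

/-- Patches from different bands: with high probability the embedding is well spread, and then its
`ε`-rank and its stable rank are of the order of `min d n`. -/
lemma one_sub_le_measure_rank {k n m d : ℕ} (hn : 0 < n) (hnm : n < m) (hd : 0 < d)
    {u : Fin n → EuclideanSpace ℝ (Fin k)} (hu : Orthonormal ℝ u) {δ : ℝ} (hδ : 0 < δ)
    (hm : Real.log (1 / δ) ≤ m) (hdδ : Real.log (1 / δ) ≤ d) {α β : ℝ≥0} (hα : 0 < α) (hβ : 0 < β)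
    {Ω : Type*} [MeasurableSpace Ω] {P : Measure Ω} [IsProbabilityMeasure P]
    {W₁ : Ω → Matrix (Fin m) (Fin k) ℝ} {W₂ : Ω → Matrix (Fin d) (Fin m) ℝ}
    (h : IsGaussianPair P α β W₁ W₂) :
    1 - δ ≤ P.real {w | (1 / 240000 / 608 : ℝ) ^ 2 * (min d n : ℕ)
          ≤ (epsRank (1 / 240000 / 608) (embedMatrix (W₁ w) (W₂ w) (centeringBias α (W₂ w))
            (patchMatrix u)) : ℝ) ∧
        (1 / 240000 / 608 : ℝ) ^ 2 * (min d n : ℕ)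
          ≤ stabRank (embedMatrix (W₁ w) (W₂ w) (centeringBias α (W₂ w)) (patchMatrix u))} := by
  have hlaw := h.hasLaw_prod hα hβ hu
  have hm0 : 0 < m := hn.trans hnm
  set G : Ω → (Fin m × Fin n → ℝ) × (Fin d × Fin m → ℝ) := fun w =>
    (fun e : Fin m × Fin n => ∑ t, W₁ w e.1 t / √(α : ℝ) * u e.2 t,
      fun e : Fin d × Fin m => W₂ w e.1 e.2 / √(β : ℝ)) with hG
  have hbad : P.real {w | G w ∈ (wellSpread m n d)ᶜ} ≤ δ := by
    rw [hlaw.measureReal_eq (p := fun x => x ∈ (wellSpread m n d)ᶜ)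
      (measurableSet_wellSpread m n d).compl]
    refine (measure_compl_wellSpread_le hn hnm).trans ?_
    have := exp_neg_three_mul_le hδ hm0 hm
    have := exp_neg_three_mul_le hδ hd hdδ
    linarith
  have hgood : 1 - δ ≤ P.real {w | G w ∈ wellSpread m n d} := by
    have h1 := measureReal_union_le (μ := P) {w | G w ∈ wellSpread m n d}
      {w | G w ∈ (wellSpread m n d)ᶜ}
    have h2 : {w | G w ∈ wellSpread m n d} ∪ {w | G w ∈ (wellSpread m n d)ᶜ} = Set.univ := by
      ext w
      simp [em]
    rw [h2, probReal_univ] at h1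
    linarith
  refine hgood.trans (measureReal_mono fun w hw => ?_)
  obtain ⟨h1, h2⟩ := mul_min_le_of_mem_wellSpread hm0 hn hd hw
  have hαβ : 0 < √(α : ℝ) * √(β : ℝ) := mul_pos (Real.sqrt_pos.2 (by exact_mod_cast hα))
    (Real.sqrt_pos.2 (by exact_mod_cast hβ))
  -- Both hypotheses below are homogeneous, so the scalar `√α √β` plays no role.
  have hkey := mul_min_le_epsRank_and_stabRank
    (embedMatrix (W₁ w) (W₂ w) (centeringBias α (W₂ w)) (patchMatrix u))
    (κ := 2 * (1 / 240000 / 608) ^ 2) (ε := 1 / 240000 / 608) (by norm_num) le_rfl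
    (by
      rw [embedMatrix_centeringBias hα hβ, specNorm_smul, abs_of_pos hαβ]
      exact mul_pos hαβ h1)
    (by
      rw [embedMatrix_centeringBias hα hβ, specNorm_smul, frobNorm_smul_sq, mul_pow, sq_abs]
      rw [mul_left_comm]
      exact mul_le_mul_of_nonneg_left h2 (sq_nonneg _))
  rwa [mul_div_cancel_left₀ _ (two_ne_zero' ℝ)] at hkey

theorem theorem1 :
    -- Patches of one band: `c₀`, `C₀` are the constants hidden in the two conditions on `φ` and `b`.
    (∀ c₀ C₀ : ℝ, 0 < c₀ → 0 < C₀ → ∃ K : ℝ, 0 < K ∧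
      ∀ (k : ℕ) [NeZero k] (n : ℕ) (ω : ℝ) (B : Fin n → Finset (Fin k)), IsBandFamily k n ω B →
      ∀ (v : Fin n → EuclideanSpace ℝ (Fin k)), (∀ i, ‖v i‖ = 1) →
      ∀ (j : Fin n), (∀ i, SupportedInBand (v i) (B j)) →
      ∀ (m d : ℕ) (W₁ : Matrix (Fin m) (Fin k) ℝ) (W₂ : Matrix (Fin d) (Fin m) ℝ)
        (b : Fin d → ℝ),
        c₀ * (specNorm W₂ * specNorm W₁ * specNorm (patchMatrix v))
          ≤ specNorm (embedMatrix W₁ W₂ b (patchMatrix v)) →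
        frobNorm (Matrix.vecMulVec b (fun _ : Fin n => (1 : ℝ)))
          ≤ C₀ * frobNorm (W₂ * (W₁ * patchMatrix v).map relu) →
        (∀ ε : ℝ, 0 < ε → ε ≤ 1 →
          (epsRank ε (embedMatrix W₁ W₂ b (patchMatrix v)) : ℝ) ≤ K * (ε ^ 2)⁻¹ * ω) ∧
        stabRank (embedMatrix W₁ W₂ b (patchMatrix v)) ≤ K * ω) ∧
    -- Patches of different bands: `a₁`, `a₂` are the constants hidden in `m / d = Θ(1)`.
    (∃ ε C : ℝ, 0 < ε ∧ 0 < C ∧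
      ∀ a₁ a₂ : ℝ, 0 < a₁ → a₁ ≤ a₂ → ∃ c : ℝ, 0 < c ∧
      ∀ (k : ℕ) [NeZero k] (n : ℕ) (ω : ℝ) (B : Fin n → Finset (Fin k)), IsBandFamily k n ω B →
      ∀ (u : Fin n → EuclideanSpace ℝ (Fin k)), (∀ i, ‖u i‖ = 1) →
      (∀ i, SupportedInBand (u i) (B i)) →
      ∀ (δ : ℝ), 0 < δ → δ < 1 →
      ∀ (m d : ℕ), C * Real.log (1 / δ) ≤ m → C * Real.log (n / δ) ≤ d → n < m →
      a₁ ≤ (m : ℝ) / d → (m : ℝ) / d ≤ a₂ →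
      ∀ (α β : ℝ≥0), 0 < α → 0 < β →
      ∀ (Ω : Type*) [MeasurableSpace Ω] (P : Measure Ω) [IsProbabilityMeasure P]
        (W₁ : Ω → Matrix (Fin m) (Fin k) ℝ) (W₂ : Ω → Matrix (Fin d) (Fin m) ℝ),
        IsGaussianPair P α β W₁ W₂ →
        1 - δ ≤ P.real {w : Ω |
          c * n ≤ (epsRank ε (embedMatrix (W₁ w) (W₂ w) (centeringBias α (W₂ w))
            (patchMatrix u)) : ℝ) ∧
          c * n ≤ stabRank (embedMatrix (W₁ w) (W₂ w) (centeringBias α (W₂ w))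
            (patchMatrix u))}) := by
  refine ⟨fun c₀ C₀ hc hC => ⟨2 * ((1 + C₀) / c₀) ^ 2, by positivity, ?_⟩,
    1 / 240000 / 608, 1, by norm_num, one_pos, fun a₁ a₂ ha₁ ha₁₂ =>
      ⟨(1 / 240000 / 608) ^ 2 * min 1 (1 / a₂), ?_, ?_⟩⟩
  · intro k _ n ω B hB v _ j hv m d W₁ W₂ b h₁ h₂
    have hω : 0 ≤ ω := le_trans (by positivity) (hB.card_le j)
    obtain ⟨h3, h4⟩ := epsRank_le_and_stabRank_le (by positivity)
      (frobNorm_embedMatrix_sq_le hc hC (hB.card_le j) v hv W₁ W₂ b h₁ h₂)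
    refine ⟨fun ε hε _ => (h3 ε hε).trans (le_of_eq (by ring)), h4⟩
  · have : 0 < a₂ := ha₁.trans_le ha₁₂
    positivity
  · intro k _ n ω B hB u hu huB δ hδ _ m d hm hd hnm had had' α β hα hβ Ω _ P _ W₁ W₂ h
    have ha₂ : 0 < a₂ := ha₁.trans_le ha₁₂
    have hn : 0 < n := zero_lt_one.trans hB.one_lt
    have hn1 : (1 : ℝ) ≤ n := by exact_mod_cast hn
    -- `d = 0` would make the junk value `m / 0 = 0` fall below `a₁`.
    have hd0 : 0 < d := by
      rcases Nat.eq_zero_or_pos d with rfl | h0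
      · simp at had
        linarith
      · exact h0
    have hd0' : (0 : ℝ) < d := by exact_mod_cast hd0
    have horth : Orthonormal ℝ u :=
      ⟨hu, fun i j hij => inner_eq_zero_of_supportedInBand (huB i) (huB j) (hB.disjoint hij)⟩
    have hdδ : Real.log (1 / δ) ≤ d := by
      refine le_trans (Real.log_le_log (by positivity) ?_) (by simpa using hd)
      gcongr
    have hmin : min 1 (1 / a₂) * n ≤ (min d n : ℕ) := by
      push_cast
      refine le_min ?_ ?_
      · calc min 1 (1 / a₂) * (n : ℝ) ≤ 1 / a₂ * m := by
              have : (n : ℝ) ≤ m := by exact_mod_cast hnm.le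
              gcongr
              exact min_le_right _ _
          _ ≤ d := by
              rw [div_le_iff₀ hd0'] at had'
              rw [one_div, inv_mul_le_iff₀ ha₂]
              exact had'
      · calc min 1 (1 / a₂) * (n : ℝ) ≤ 1 * n := by
              gcongr
              exact min_le_left _ _
          _ = n := one_mul _
    have hc : (1 / 240000 / 608) ^ 2 * min 1 (1 / a₂) * (n : ℝ)
        ≤ (1 / 240000 / 608) ^ 2 * (min d n : ℕ) := by
      rw [mul_assoc]
      exact mul_le_mul_of_nonneg_left hmin (by positivity)
    refine (one_sub_le_measure_rank hn hnm hd0 horth hδ (by simpa using hm) hdδ hα hβ h).trans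
      (measureReal_mono fun w hw => ⟨hc.trans hw.1, hc.trans hw.2⟩)
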